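/- For $n \ge 1$ let $P_n$ be the number of passes that bubble sort requires on a uniformly random permutation of $n$ distinct numbers. Here the $i$-th pass compares, for $j = 1, \dots, n-i$ in this order, the $j$-th and the $(j+1)$-th element and swaps them if they are out of order, and $P_n$ is the least $i+1$ with $i \ge 0$ such that the sequence is sorted at the end of the $i$-th pass (the input being the sequence at the end of the $0$-th pass). Put $$X_n = \frac{n - P_n}{\sqrt n}, \qquad \varphi_{X_n}(t) = \mathbb{E}\, e^{\mathrm{i} t X_n} \quad (t \in \mathbb{R}),$$ and let $\Phi(z) = \frac12\left(\operatorname{erf}\left(\frac{z}{\sqrt2}\right) + 1\right)$, where $\operatorname{erf}(z) = \frac{2}{\sqrt\pi}\int_0^z e^{-w^2}\,\mathrm{d}w$ for $z \in \mathbb{C}$, be the standard normal cumulative distribution function extended to complex arguments. Let $$A_n(t) = \left(1 - \frac{(6 - t^2)\,\mathrm{i}t}{3\sqrt n}\right)\sqrt{2\pi}\; e^{-t^2/2}\;\mathrm{i}t\;\Phi(\mathrm{i}t) + \left(1 - \frac{(5 - t^2)\,\mathrm{i}t}{3\sqrt n}\right).$$ Then, for every fixed $t \in \mathbb{R}$,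 $$\varphi_{X_n}(t) = A_n(t) + O\left(\frac1n\right) \qquad (n \to \infty),$$ and for every fixed $t \ne 0$ the error is of exact order $\frac1n$, that is, $\left|\varphi_{X_n}(t) - A_n(t)\right| = \Theta\left(\frac1n\right)$ as $n \to \infty$. -/

import Mathlib

open Asymptotics Filter

namespace BubbleSort

/-- Compare the neighbours at the (zero-based) positions `j` and `j + 1` of the sequence `a` and
swap them if they are out of order. -/
def compareSwap {α : Type*} [LinearOrder α] {n : ℕ} (a : Fin n → α) (j : ℕ) : Fin n → α :=
  if h : j + 1 < n then
    if a ⟨j, Nat.lt_of_succ_lt h⟩ > a ⟨j + 1, h⟩ then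
      a ∘ Equiv.swap ⟨j, Nat.lt_of_succ_lt h⟩ ⟨j + 1, h⟩
    else a
  else a

/-- The sequence after the first `j` comparisons of a left-to-right traversal. -/
def traverse {α : Type*} [LinearOrder α] {n : ℕ} (a : Fin n → α) : ℕ → (Fin n → α)
  | 0 => a
  | j + 1 => compareSwap (traverse a j) j

/-- The sequence at the end of the `i`-th pass of bubble sort; the `i`-th pass makes `n - i`
comparisons. -/
def afterPass {α : Type*} [LinearOrder α] {n : ℕ} (a : Fin n → α) : ℕ → (Fin n → α)
  | 0 => a
  | i + 1 => traverse (afterPass a i) (n - (i + 1))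

/-- The number of passes required to bubble sort `a`: the least `i + 1` such that the sequence is
sorted at the end of the `i`-th pass (the last pass only checks that nothing is out of order). -/
noncomputable def passes {α : Type*} [LinearOrder α] {n : ℕ} (a : Fin n → α) : ℕ :=
  sInf {p : ℕ | ∃ i : ℕ, p = i + 1 ∧ Monotone (afterPass a i)}

/-- The random variable `X_n = (n - P_n) / √n` on the space of permutations of the positions of the
fixed sequence `a` of `n` numbers. -/
noncomputable def standardizedPasses {α : Type*} [LinearOrder α] {n : ℕ} (a : Fin n → α)
    (σ : Equiv.Perm (Fin n)) : ℝ :=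
  ((n : ℝ) - (passes (a ∘ σ) : ℝ)) / √(n : ℝ)

/-- The law of `X_n` when the input is a uniformly random permutation of `a`. -/
noncomputable def standardizedPassesLaw {α : Type*} [LinearOrder α] {n : ℕ} (a : Fin n → α) :
    MeasureTheory.Measure ℝ :=
  ((PMF.uniformOfFintype (Equiv.Perm (Fin n))).map (standardizedPasses a)).toMeasure

/-- The entire error function `erf z = (2 / √π) ∫_0^z exp (-w ^ 2) dw`, the integral being taken
along the segment from `0` to `z`. -/
noncomputable def erf (z : ℂ) : ℂ :=
  2 / (√Real.pi : ℂ) * ∫ s in (0 : ℝ)..1, z * Complex.exp (-((s : ℂ) * z) ^ 2)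

/-- The cumulative distribution function of the standard normal law, extended to `ℂ`. -/
noncomputable def normalCDF (z : ℂ) : ℂ :=
  1 / 2 * (erf (z / (√2 : ℝ)) + 1)

/-- The first-order approximation of the characteristic function of `X_n` at `t`. -/
noncomputable def charFunApprox (n : ℕ) (t : ℝ) : ℂ :=
  (1 - (6 - (t : ℂ) ^ 2) * (Complex.I * t) / (3 * (√(n : ℝ) : ℝ))) *
      ((√(2 * Real.pi) : ℝ) * Complex.exp (-(t : ℂ) ^ 2 / 2) * (Complex.I * t) *
        normalCDF (Complex.I * t)) +
    (1 - (5 - (t : ℂ) ^ 2) * (Complex.I * t) / (3 * (√(n : ℝ) : ℝ)))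

end BubbleSort

/-! A pass carries the running maximum to the right, so it shifts the Lehmer code one place to the
left and lowers each entry by one. Hence `i` passes sort the sequence iff every entry is at most `i`
(`passes_le_iff`). Since the Lehmer code is a bijection onto a product of ranges, `n - P_n ≥ j` has
the explicit probability `tailRatio n j`.

With `h = 1 / √n` and `τ = i t`, summation by parts gives `φ = 1 + W S`, where `W = (1 - exp (-τ h))
/ h` and `S` is `h` times the sum of `tailRatio n j * exp (τ h j)` over `j ≥ 1`. At `x = h j` the
tail is `exp (-x ^ 2 / 2)` times a polynomial in `h` and `x`, up to `O(h ^ 3)` with Gaussian decay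
(`abs_tailRatio_sub_le`). Euler–Maclaurin turns the sums into half-line integrals with boundary
corrections. Integration by parts reduces these to `M = halfMoment t 1`, which solves a linear
differential equation in `t` and equals `√(2π) exp (-t ^ 2 / 2) Φ(i t)`.

Multiplying the expansions, orders `1` and `h` form `A_n`, and order `h ^ 2 = 1 / n` has coefficient
`secondOrderCoeff t`. For `t ≠ 0` it does not vanish: `M` has positive real part, and the two real
polynomials in the coefficient have no common root. -/

namespace BubbleSort

/-! ### Bubble sort passes acting on the Lehmer code -/

/-- The number of larger elements that precede the element at the position `l`. -/
def inversionsAt {α : Type*} [LinearOrder α] {n : ℕ} (a : Fin n → α) (l : Fin n) : ℕ :=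
  (Finset.univ.filter fun k => k < l ∧ a l < a k).card

section Passes

variable {α : Type*} [LinearOrder α] {n : ℕ}

lemma inversionsAt_eq_zero_iff {a : Fin n → α} {l : Fin n} :
    inversionsAt a l = 0 ↔ ∀ k < l, a k ≤ a l := by
  simp [inversionsAt, Finset.filter_eq_empty_iff]

lemma inversionsAt_le (a : Fin n → α) (l : Fin n) : inversionsAt a l ≤ l := by
  calc inversionsAt a l ≤ (Finset.Iio l).card := by
        refine Finset.card_le_card fun k hk => ?_
        simp only [Finset.mem_filter] at hk
        simpa using hk.2.1
    _ = l := by simp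

lemma monotone_iff_inversionsAt {a : Fin n → α} : Monotone a ↔ ∀ l, inversionsAt a l = 0 := by
  simp only [inversionsAt_eq_zero_iff]
  refine ⟨fun h l k hk => h hk.le, fun h k l hkl => ?_⟩
  rcases hkl.eq_or_lt with rfl | hlt
  · exact le_rfl
  · exact h l k hlt

/-- The element at `j` is a running maximum. If it is swapped, its neighbour moves left past exactly
one larger element; if not, both entries are zero and the truncated subtraction gives `0 - 1 = 0`.
-/
lemma inversionsAt_compareSwap_left {a : Fin n → α} {j : ℕ} (hj : j + 1 < n)
    (h0 : inversionsAt a ⟨j, Nat.lt_of_succ_lt hj⟩ = 0) :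
    inversionsAt (compareSwap a j) ⟨j, Nat.lt_of_succ_lt hj⟩ =
      inversionsAt a ⟨j + 1, hj⟩ - 1 := by
  rw [inversionsAt_eq_zero_iff] at h0
  unfold compareSwap
  rw [dif_pos hj]
  split_ifs with hgt
  · have hmem : (⟨j, Nat.lt_of_succ_lt hj⟩ : Fin n) ∈ Finset.univ.filter
        fun k => k < (⟨j + 1, hj⟩ : Fin n) ∧ a ⟨j + 1, hj⟩ < a k := by
      simpa [Fin.lt_def] using hgt
    unfold inversionsAt
    rw [← Finset.card_erase_of_mem hmem]
    congr 1
    ext k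
    simp only [Finset.mem_filter, Finset.mem_univ, true_and, Finset.mem_erase, Function.comp_apply,
      Equiv.swap_apply_left, ne_eq, Fin.lt_def, Fin.ext_iff]
    constructor
    · rintro ⟨hk, hlt⟩
      rw [Equiv.swap_apply_of_ne_of_ne (by simp [Fin.ext_iff]; omega)
        (by simp [Fin.ext_iff]; omega)] at hlt
      exact ⟨by omega, by omega, hlt⟩
    · rintro ⟨hne, hk, hlt⟩
      rw [Equiv.swap_apply_of_ne_of_ne (by simpa [Fin.ext_iff] using hne)
        (by simp [Fin.ext_iff]; omega)]
      exact ⟨by omega, hlt⟩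
  · have h1 : inversionsAt a ⟨j + 1, hj⟩ = 0 := by
      rw [inversionsAt_eq_zero_iff]
      intro k hk
      rcases (Nat.lt_succ_iff.mp hk).eq_or_lt with he | hlt
      · have : k = ⟨j, Nat.lt_of_succ_lt hj⟩ := Fin.ext he
        rw [this]
        exact not_lt.mp hgt
      · exact (h0 k hlt).trans (not_lt.mp hgt)
    rw [h1, inversionsAt_eq_zero_iff]
    exact h0

lemma inversionsAt_compareSwap_right {a : Fin n → α} {j : ℕ} (hj : j + 1 < n)
    (h0 : inversionsAt a ⟨j, Nat.lt_of_succ_lt hj⟩ = 0) :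
    inversionsAt (compareSwap a j) ⟨j + 1, hj⟩ = 0 := by
  rw [inversionsAt_eq_zero_iff] at h0 ⊢
  intro k hk
  unfold compareSwap
  rw [dif_pos hj]
  split_ifs with hgt
  · rw [Function.comp_apply, Function.comp_apply, Equiv.swap_apply_right]
    rcases (Nat.lt_succ_iff.mp hk).eq_or_lt with he | hlt
    · have : k = ⟨j, Nat.lt_of_succ_lt hj⟩ := Fin.ext he
      rw [this, Equiv.swap_apply_left]
      exact le_of_lt hgt
    · rw [Equiv.swap_apply_of_ne_of_ne (by simp [Fin.ext_iff]; omega)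
        (by simp [Fin.ext_iff]; omega)]
      exact h0 k hlt
  · rcases (Nat.lt_succ_iff.mp hk).eq_or_lt with he | hlt
    · have : k = ⟨j, Nat.lt_of_succ_lt hj⟩ := Fin.ext he
      rw [this]
      exact not_lt.mp hgt
    · exact (h0 k hlt).trans (not_lt.mp hgt)

lemma inversionsAt_compareSwap_of_ne (a : Fin n → α) {j : ℕ} {l : Fin n} (h1 : (l : ℕ) ≠ j)
    (h2 : (l : ℕ) ≠ j + 1) : inversionsAt (compareSwap a j) l = inversionsAt a l := by
  unfold compareSwap
  split_ifs with hj hgt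
  · unfold inversionsAt
    refine Finset.card_equiv (Equiv.swap ⟨j, Nat.lt_of_succ_lt hj⟩ ⟨j + 1, hj⟩) fun k => ?_
    have hl : Equiv.swap (⟨j, Nat.lt_of_succ_lt hj⟩ : Fin n) ⟨j + 1, hj⟩ l = l :=
      Equiv.swap_apply_of_ne_of_ne (by simpa [Fin.ext_iff] using h1)
        (by simpa [Fin.ext_iff] using h2)
    simp only [Finset.mem_filter, Finset.mem_univ, true_and, Function.comp_apply, hl]
    refine and_congr_left fun _ => ?_
    rw [Equiv.swap_apply_def]
    split_ifs with e1 e2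
    · subst e1
      simp only [Fin.lt_def]
      omega
    · subst e2
      simp only [Fin.lt_def]
      omega
    · rfl
  · rfl
  · rfl

/-- Loop invariant of a pass: the running maximum sits at position `j`, everything before it has
been shifted, everything after it is untouched. -/
lemma inversionsAt_traverse (a : Fin n → α) (j : ℕ) (hj : j < n) (l : Fin n) :
    inversionsAt (traverse a j) l =
      if h : (l : ℕ) < j then inversionsAt a ⟨l + 1, by omega⟩ - 1
      else if (l : ℕ) = j then 0 else inversionsAt a l := by
  induction j generalizing l with
  | zero =>
    simp only [traverse, Nat.not_lt_zero, dite_false]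
    split_ifs with h
    · have := inversionsAt_le a l
      omega
    · rfl
  | succ j ih =>
    have ih' := ih (by omega)
    have h0 : inversionsAt (traverse a j) ⟨j, Nat.lt_of_succ_lt hj⟩ = 0 := by
      rw [ih']; simp
    simp only [traverse]
    rcases lt_trichotomy (l : ℕ) j with h | h | h
    · rw [inversionsAt_compareSwap_of_ne _ (by omega) (by omega), ih', dif_pos h,
        dif_pos (by omega)]
    · obtain rfl : l = ⟨j, Nat.lt_of_succ_lt hj⟩ := Fin.ext h
      rw [inversionsAt_compareSwap_left hj h0, dif_pos (by simp), ih']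
      simp
    · rw [dif_neg (by omega)]
      split_ifs with h'
      · obtain rfl : l = ⟨j + 1, hj⟩ := Fin.ext h'
        exact inversionsAt_compareSwap_right hj h0
      · rw [inversionsAt_compareSwap_of_ne _ (by omega) h', ih', dif_neg (by omega),
          if_neg (by omega)]

/-- Every pass shifts the Lehmer code to the left and decreases its entries. -/
lemma inversionsAt_afterPass (a : Fin n → α) (i : ℕ) (l : Fin n) :
    inversionsAt (afterPass a i) l =
      if h : l + i < n then inversionsAt a ⟨l + i, h⟩ - i else 0 := by
  induction i generalizing l with
  | zero => simp [afterPass]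
  | succ i ih =>
    rw [afterPass, inversionsAt_traverse _ _ (by have := l.2; omega)]
    have hl := l.2
    split_ifs with h1 h2 h3 h4 h5
    · have he : (⟨(l : ℕ) + 1 + i, by omega⟩ : Fin n) = ⟨l + (i + 1), h2⟩ :=
        Fin.ext (by simp only; omega)
      rw [ih, dif_pos (by simp only; omega), Nat.sub_sub, he]
    · omega
    · omega
    · rfl
    · omega
    · rw [ih]
      split_ifs with h6
      · have h7 : n < i + 1 := by omega
        have := inversionsAt_le a ⟨l + i, h6⟩
        simp only at this
        omega
      · rfl

/-- Entries at positions below `i` are at most `i` anyway; an entry at `l ≥ i` reaches position `l -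
i` lowered by `i`, and vanishes iff it was at most `i`. -/
lemma monotone_afterPass_iff (a : Fin n → α) (i : ℕ) :
    Monotone (afterPass a i) ↔ ∀ l, inversionsAt a l ≤ i := by
  rw [monotone_iff_inversionsAt]
  constructor
  · intro h l
    by_cases hl : (l : ℕ) < i
    · exact (inversionsAt_le a l).trans hl.le
    · have h1 := h ⟨l - i, by omega⟩
      rw [inversionsAt_afterPass, dif_pos (by simp only; omega)] at h1
      have : (⟨(l : ℕ) - i + i, by omega⟩ : Fin n) = l := Fin.ext (by simp only; omega)
      simp only [this] at h1
      omega
  · intro h l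
    rw [inversionsAt_afterPass]
    split_ifs with h1
    · have := h ⟨l + i, h1⟩
      omega
    · rfl

lemma passes_le_iff (a : Fin n → α) (i : ℕ) :
    passes a ≤ i + 1 ↔ ∀ l, inversionsAt a l ≤ i := by
  -- Nonemptiness matters because `sInf ∅ = 0` in `ℕ`; `n` passes always suffice.
  have hne : {p : ℕ | ∃ i : ℕ, p = i + 1 ∧ Monotone (afterPass a i)}.Nonempty :=
    ⟨n + 1, n, rfl, (monotone_afterPass_iff a n).2 fun l =>
      (inversionsAt_le a l).trans l.2.le⟩
  constructor
  · intro h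
    obtain ⟨m, hm, hmono⟩ := Nat.sInf_mem hne
    rw [monotone_afterPass_iff] at hmono
    intro l
    have : m ≤ i := by
      change sInf _ ≤ _ at h
      omega
    exact (hmono l).trans this
  · intro h
    exact Nat.sInf_le ⟨i, rfl, (monotone_afterPass_iff a i).2 h⟩

lemma one_le_passes (a : Fin n → α) : 1 ≤ passes a := by
  have hne : {p : ℕ | ∃ i : ℕ, p = i + 1 ∧ Monotone (afterPass a i)}.Nonempty :=
    ⟨n + 1, n, rfl, (monotone_afterPass_iff a n).2 fun l =>
      (inversionsAt_le a l).trans l.2.le⟩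
  obtain ⟨m, hm, -⟩ := Nat.sInf_mem hne
  change 1 ≤ sInf _
  omega

lemma passes_le_length (a : Fin n → α) (hn : 1 ≤ n) : passes a ≤ n := by
  obtain ⟨m, rfl⟩ : ∃ m, n = m + 1 := ⟨n - 1, by omega⟩
  rw [passes_le_iff]
  intro l
  have := inversionsAt_le a l
  omega

lemma inversionsAt_comp_strictMono {β : Type*} [LinearOrder β] {f : α → β} (hf : StrictMono f)
    (a : Fin n → α) : inversionsAt (f ∘ a) = inversionsAt a := by
  ext l
  simp [inversionsAt, hf.lt_iff_lt]

end Passes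

/-! ### Bijectivity of the Lehmer code -/

section LehmerCode

variable {n : ℕ}

/-- The Lehmer code of a permutation. -/
def lehmerCode (σ : Equiv.Perm (Fin n)) (l : Fin n) : Fin ((l : ℕ) + 1) :=
  ⟨inversionsAt σ l, Nat.lt_succ_of_le (inversionsAt_le σ l)⟩

/-- In this form the entry depends only on `σ l` and the values to the right of `l`, so `σ` can be
recovered from right to left. -/
lemma inversionsAt_perm (σ : Equiv.Perm (Fin n)) (l : Fin n) :
    inversionsAt σ l =
      (Finset.univ.filter fun v => σ l < v ∧ ∀ k, l < k → σ k ≠ v).card := by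
  unfold inversionsAt
  refine Finset.card_equiv σ fun k => ?_
  simp only [Finset.mem_filter, Finset.mem_univ, true_and, ne_eq, EmbeddingLike.apply_eq_iff_eq]
  constructor
  · rintro ⟨h1, h2⟩
    exact ⟨h2, fun m hm he => absurd (he ▸ hm) (not_lt.2 h1.le)⟩
  · rintro ⟨h1, h2⟩
    refine ⟨?_, h1⟩
    by_contra hk
    rcases (not_lt.1 hk).eq_or_lt with he | hlt
    · exact absurd h1 (by rw [he]; exact lt_irrefl _)
    · exact h2 k hlt rfl

/-- If `σ l < τ l`, the values counted for `τ` would form a proper subset of those counted for `σ`,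
which also include `τ l`. -/
lemma not_apply_lt_of_inversionsAt_eq {σ τ : Equiv.Perm (Fin n)} {l : Fin n}
    (hl : inversionsAt σ l = inversionsAt τ l) (h : ∀ k, l < k → σ k = τ k) : ¬ σ l < τ l := by
  intro hlt
  rw [inversionsAt_perm, inversionsAt_perm] at hl
  refine absurd hl (ne_of_gt (Finset.card_lt_card ?_))
  rw [Finset.ssubset_iff_of_subset]
  · refine ⟨τ l, ?_, by simp⟩
    simp only [Finset.mem_filter, Finset.mem_univ, true_and]
    refine ⟨hlt, fun k hk he => ?_⟩
    rw [h k hk] at he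
    exact absurd (τ.injective he) (ne_of_gt hk)
  · intro v
    simp only [Finset.mem_filter, Finset.mem_univ, true_and]
    rintro ⟨h1, h2⟩
    exact ⟨hlt.trans h1, fun k hk => by rw [h k hk]; exact h2 k hk⟩

lemma lehmerCode_injective : Function.Injective (lehmerCode (n := n)) := by
  intro σ τ h
  have hinv : ∀ l, inversionsAt σ l = inversionsAt τ l := fun l => by
    simpa [lehmerCode] using congrArg Fin.val (congrFun h l)
  have key : ∀ m : ℕ, ∀ l : Fin n, n - 1 - l = m → σ l = τ l := by
    intro m
    induction m using Nat.strong_induction_on with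
    | _ m ih =>
      intro l hl
      have hk : ∀ k, l < k → σ k = τ k := fun k hk =>
        ih (n - 1 - k) (by have := k.2; rw [Fin.lt_def] at hk; omega) k rfl
      exact le_antisymm
        (not_lt.1 (not_apply_lt_of_inversionsAt_eq (hinv l).symm fun k h' => (hk k h').symm))
        (not_lt.1 (not_apply_lt_of_inversionsAt_eq (hinv l) hk))
  exact Equiv.ext fun l => key _ l rfl

lemma lehmerCode_bijective : Function.Bijective (lehmerCode (n := n)) := by
  rw [Fintype.bijective_iff_injective_and_card]
  refine ⟨lehmerCode_injective, ?_⟩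
  rw [Fintype.card_perm, Fintype.card_fin, Fintype.card_pi]
  simp only [Fintype.card_fin]
  rw [Fin.prod_univ_eq_prod_range (fun i => i + 1) n, Finset.prod_range_add_one_eq_factorial]

/-- Under the bijection the entries vary independently, the one at `l` over `l + 1` values, so the
count factors. -/
lemma card_inversionsAt_le (i : ℕ) :
    (Finset.univ.filter fun σ : Equiv.Perm (Fin n) => ∀ l, inversionsAt σ l ≤ i).card =
      ∏ l ∈ Finset.range n, min (l + 1) (i + 1) := by
  have h1 : (Finset.univ.filter fun σ : Equiv.Perm (Fin n) => ∀ l, inversionsAt σ l ≤ i).card =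
      (Fintype.piFinset fun l : Fin n =>
        Finset.univ.filter fun x : Fin ((l : ℕ) + 1) => (x : ℕ) ≤ i).card := by
    refine Finset.card_bijective lehmerCode lehmerCode_bijective fun σ => ?_
    simp [lehmerCode]
  rw [h1, Fintype.card_piFinset, ← Fin.prod_univ_eq_prod_range (fun l => min (l + 1) (i + 1)) n]
  refine Finset.prod_congr rfl fun l _ => ?_
  rw [← Finset.card_range (min ((l : ℕ) + 1) (i + 1)), ← Finset.card_map Fin.valEmbedding]
  congr 1
  ext x
  simp only [Finset.mem_map, Finset.mem_filter, Finset.mem_univ, true_and, Fin.valEmbedding_apply,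
    Finset.mem_range, lt_min_iff]
  constructor
  · rintro ⟨y, hy, rfl⟩
    exact ⟨y.2, by omega⟩
  · rintro ⟨h2, h3⟩
    exact ⟨⟨x, h2⟩, by simp only; omega, rfl⟩

end LehmerCode

/-! ### Law of the number of passes and the characteristic function as a sum -/

lemma card_passes_le {α : Type*} [LinearOrder α] {n : ℕ} {a : Fin n → α}
    (ha : Function.Injective a) (i : ℕ) :
    (Finset.univ.filter fun σ : Equiv.Perm (Fin n) => passes (a ∘ σ) ≤ i + 1).card =
      ∏ l ∈ Finset.range n, min (l + 1) (i + 1) := by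
  rw [← card_inversionsAt_le]
  simp only [passes_le_iff]
  -- Only relative order matters: relabelling by the sorting permutation reduces to permutations of
  -- `Fin n`.
  have hmono : StrictMono (a ∘ Tuple.sort a) :=
    (Tuple.monotone_sort a).strictMono_of_injective (ha.comp (Tuple.sort a).injective)
  refine Finset.card_equiv (Equiv.mulLeft (Tuple.sort a)⁻¹) fun σ => ?_
  have h : a ∘ σ = (a ∘ Tuple.sort a) ∘ ((Tuple.sort a)⁻¹ * σ : Equiv.Perm (Fin n)) := by
    ext x
    simp
  simp only [Finset.mem_filter, Finset.mem_univ, true_and, Equiv.coe_mulLeft]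
  rw [h, inversionsAt_comp_strictMono hmono]

/-- The probability that a uniformly random permutation of `n` numbers needs at most `n - j`
passes. -/
noncomputable def tailRatio (n j : ℕ) : ℝ := ∏ l ∈ Finset.range j, ((n : ℝ) - j) / ((n : ℝ) - l)

lemma tailRatio_eq_zero {n j : ℕ} (h : n < j) : tailRatio n j = 0 :=
  -- The factor `l = n` has denominator zero, so it is zero by the convention for division.
  Finset.prod_eq_zero (Finset.mem_range.2 h) (by simp)

lemma tailRatio_self {n : ℕ} (hn : 1 ≤ n) : tailRatio n n = 0 :=
  Finset.prod_eq_zero (Finset.mem_range.2 hn) (by simp)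

lemma factorial_mul_tailRatio {n j : ℕ} (h : j < n) :
    (n.factorial : ℝ) * tailRatio n j = ∏ l ∈ Finset.range n, ((min (l + 1) (n - j) : ℕ) : ℝ) := by
  have h1 : (n.factorial : ℝ) =
      ((n - j).factorial : ℝ) * ∏ l ∈ Finset.range j, ((n : ℝ) - l) := by
    rw [← Nat.factorial_mul_descFactorial h.le, Nat.descFactorial_eq_prod_range]
    push_cast
    congr 1
    refine Finset.prod_congr rfl fun l hl => ?_
    rw [Finset.mem_range] at hl
    rw [Nat.cast_sub (by omega)]
  have h2 : ∏ l ∈ Finset.range j, ((n : ℝ) - l) ≠ 0 := by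
    refine Finset.prod_ne_zero_iff.2 fun l hl => ?_
    rw [Finset.mem_range] at hl
    have : (l : ℝ) < n := by exact_mod_cast hl.trans h
    linarith
  have h3 : ∏ l ∈ Finset.range n, ((min (l + 1) (n - j) : ℕ) : ℝ) =
      ((n - j).factorial : ℝ) * ((n : ℝ) - j) ^ j := by
    -- The first `n - j` factors of the product of minima give `(n - j)!`, the other `j` are all `n
    -- - j`.
    have hn : n = (n - j) + j := by omega
    have : ∏ l ∈ Finset.range n, ((min (l + 1) (n - j) : ℕ) : ℝ) =
        ∏ l ∈ Finset.range ((n - j) + j), ((min (l + 1) (n - j) : ℕ) : ℝ) := by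
      rw [← hn]
    rw [this, Finset.prod_range_add, ← Finset.prod_range_add_one_eq_factorial]
    push_cast
    congr 1
    · refine Finset.prod_congr rfl fun l hl => ?_
      rw [Finset.mem_range] at hl
      exact min_eq_left (by exact_mod_cast hl)
    · have : ∀ l ∈ Finset.range j, min (((n - j : ℕ) : ℝ) + l + 1) ((n - j : ℕ) : ℝ) =
          (n : ℝ) - j := fun l _ => by
        rw [Nat.cast_sub h.le]
        exact min_eq_right (by linarith [(Nat.cast_nonneg l : (0 : ℝ) ≤ l)])
      rw [Finset.prod_congr rfl this]
      simp
  rw [h3, h1, tailRatio, Finset.prod_div_distrib, Finset.prod_const, Finset.card_range]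
  field_simp

lemma card_le_sub_passes {α : Type*} [LinearOrder α] {n : ℕ} (hn : 1 ≤ n) {a : Fin n → α}
    (ha : Function.Injective a) (j : ℕ) :
    ((Finset.univ.filter fun σ : Equiv.Perm (Fin n) => j ≤ n - passes (a ∘ σ)).card : ℝ) =
      (n.factorial : ℝ) * tailRatio n j := by
  rcases lt_or_ge j n with hj | hj
  · rw [factorial_mul_tailRatio hj, ← Nat.cast_prod]
    obtain ⟨i, hi⟩ : ∃ i, n - j = i + 1 := ⟨n - j - 1, by omega⟩
    rw [hi, ← card_passes_le ha]
    congr 2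
    ext σ
    have := passes_le_length (a ∘ σ) hn
    simp only [Finset.mem_filter, Finset.mem_univ, true_and]
    omega
  · have h0 : tailRatio n j = 0 := by
      rcases hj.eq_or_lt with rfl | h
      · exact tailRatio_self hn
      · exact tailRatio_eq_zero h
    rw [h0, mul_zero, Nat.cast_eq_zero, Finset.card_eq_zero, Finset.filter_eq_empty_iff]
    intro σ _
    have := one_le_passes (a ∘ σ)
    omega

/-- Summation by parts: averaged over permutations, the indicators become tail probabilities. The
free cutoff `J` allows one range for all permutations. -/
lemma pow_eq_one_add_sum {m J : ℕ} (h : m ≤ J) (z : ℂ) :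
    z ^ m = 1 + ∑ j ∈ Finset.range J, if j + 1 ≤ m then z ^ (j + 1) - z ^ j else 0 := by
  have h1 : (∑ j ∈ Finset.range J, if j + 1 ≤ m then z ^ (j + 1) - z ^ j else 0) =
      ∑ j ∈ Finset.range m, (z ^ (j + 1) - z ^ j) := by
    rw [← Finset.sum_filter]
    refine Finset.sum_congr ?_ fun _ _ => rfl
    ext j
    simp only [Finset.mem_filter, Finset.mem_range]
    omega
  rw [h1, Finset.sum_range_sub]
  simp

lemma charFun_standardizedPassesLaw {α : Type*} [LinearOrder α] {n : ℕ} (a : Fin n → α) (t : ℝ) :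
    MeasureTheory.charFun (standardizedPassesLaw a) t =
      (n.factorial : ℂ)⁻¹ * ∑ σ : Equiv.Perm (Fin n),
        Complex.exp (t * (standardizedPasses a σ : ℂ) * Complex.I) := by
  -- For the discrete σ-algebra every function of the permutation is measurable.
  let : MeasurableSpace (Equiv.Perm (Fin n)) := ⊤
  rw [MeasureTheory.charFun_apply_real, standardizedPassesLaw,
    ← PMF.toMeasure_map _ _ measurable_from_top,
    MeasureTheory.integral_map measurable_from_top.aemeasurable
      (by fun_prop), PMF.integral_eq_sum, Finset.mul_sum]
  refine Finset.sum_congr rfl fun σ _ => ?_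
  rw [PMF.uniformOfFintype_apply, Fintype.card_perm, Fintype.card_fin, ENNReal.toReal_inv,
    ENNReal.toReal_natCast, Complex.real_smul]
  push_cast
  rfl

lemma charFun_eq_sum_tailRatio {α : Type*} [LinearOrder α] {n : ℕ} (hn : 1 ≤ n) {a : Fin n → α}
    (ha : Function.Injective a) (t : ℝ) {J : ℕ} (hJ : n ≤ J) :
    MeasureTheory.charFun (standardizedPassesLaw a) t =
      1 + (1 - Complex.exp (-(Complex.I * t * ((1 / √(n : ℝ) : ℝ) : ℂ)))) *
        ∑ j ∈ Finset.range J, (tailRatio n (j + 1) : ℂ) *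
          Complex.exp (Complex.I * t * (((1 / √(n : ℝ)) * ((j + 1 : ℕ) : ℝ) : ℝ) : ℂ)) := by
  set z : ℂ := Complex.exp (Complex.I * t * ((1 / √(n : ℝ) : ℝ) : ℂ)) with hz
  have hσ : ∀ σ : Equiv.Perm (Fin n),
      Complex.exp (t * (standardizedPasses a σ : ℂ) * Complex.I) =
        z ^ (n - passes (a ∘ σ)) := fun σ => by
    rw [hz, ← Complex.exp_nat_mul, standardizedPasses, Nat.cast_sub (passes_le_length _ hn)]
    congr 1
    push_cast
    ring
  have hj : ∀ j : ℕ, Complex.exp (Complex.I * t * (((1 / √(n : ℝ)) * (j : ℝ) : ℝ) : ℂ)) =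
      z ^ j := fun j => by
    rw [hz, ← Complex.exp_nat_mul]
    congr 1
    push_cast
    ring
  have hf : (n.factorial : ℂ) ≠ 0 := by exact_mod_cast n.factorial_ne_zero
  rw [charFun_standardizedPassesLaw, Complex.exp_neg, ← hz]
  have hexp : ∀ σ : Equiv.Perm (Fin n), z ^ (n - passes (a ∘ σ)) = 1 + ∑ j ∈ Finset.range J,
      if j + 1 ≤ n - passes (a ∘ σ) then z ^ (j + 1) - z ^ j else 0 :=
    fun σ => pow_eq_one_add_sum (by omega) z
  simp_rw [hσ, hj, hexp]
  rw [Finset.sum_add_distrib, Finset.sum_comm, mul_add]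
  congr 1
  · simp [Fintype.card_perm, hf]
  · rw [Finset.mul_sum, Finset.mul_sum]
    refine Finset.sum_congr rfl fun j _ => ?_
    have hc := card_le_sub_passes hn ha (j + 1)
    have hc' : ((Finset.univ.filter fun σ : Equiv.Perm (Fin n) =>
        j + 1 ≤ n - passes (a ∘ σ)).card : ℂ) = (n.factorial : ℂ) * (tailRatio n (j + 1) : ℂ) := by
      exact_mod_cast congrArg (fun x : ℝ => (x : ℂ)) hc
    have hz0 : z ≠ 0 := Complex.exp_ne_zero _
    -- Here `z ^ (j + 1) - z ^ j = (1 - z⁻¹) * z ^ (j + 1)`.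
    rw [← Finset.sum_filter, Finset.sum_const, nsmul_eq_mul, hc', pow_succ]
    field_simp

/-! ### Second-order Gaussian approximation of the tail probabilities -/

section TailRatioEstimate

open Real

/-- No smallness of `u` is needed: for `|u| > 1` the exponential is at most `1` and every term is
dominated by `|u| ^ 3`. -/
lemma abs_exp_sub_quadratic_le {u : ℝ} (hu : u ≤ 0) :
    |exp u - (1 + u + u ^ 2 / 2)| ≤ 3 * |u| ^ 3 := by
  rcases le_or_gt |u| 1 with h | h
  · have h1 := Real.exp_bound h (n := 3) (by norm_num)
    norm_num [Finset.sum_range_succ, Nat.factorial] at h1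
    have h2 : 0 ≤ |u| ^ 3 := by positivity
    calc _ ≤ |u| ^ 3 * (2 / 9) := h1
      _ ≤ _ := by linarith
  · have h1 : exp u ≤ 1 := exp_le_one_iff.2 hu
    have h2 := exp_pos u
    have h3 : u ^ 2 = |u| ^ 2 := (sq_abs u).symm
    have h4 : u = -|u| := by rw [abs_of_nonpos hu, neg_neg]
    have h5 : |u| ≤ |u| ^ 3 := le_self_pow₀ h.le (by norm_num)
    have h6 : |u| ^ 2 ≤ |u| ^ 3 := pow_le_pow_right₀ h.le (by norm_num)
    rw [abs_le]
    constructor <;> nlinarith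

lemma tailRatio_nonneg {n j : ℕ} (h : j ≤ n) : 0 ≤ tailRatio n j := by
  refine Finset.prod_nonneg fun l hl => div_nonneg ?_ ?_
  · exact sub_nonneg.2 (by exact_mod_cast h)
  · exact sub_nonneg.2 (by rw [Finset.mem_range] at hl; exact_mod_cast (hl.le.trans h))

/-- Each factor is at most `1 - (j - l) / n ≤ exp (-(j - l) / n)`, and the numbers `j - l` add up to
`j (j + 1) / 2 ≥ j ^ 2 / 2`. -/
lemma tailRatio_le_exp {n j : ℕ} (h : j ≤ n) :
    tailRatio n j ≤ exp (-((j : ℝ) ^ 2 / (2 * n))) := by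
  rcases Nat.eq_zero_or_pos n with rfl | hn
  · simp [tailRatio, Nat.le_zero.1 h]
  have hn' : (0 : ℝ) < n := by exact_mod_cast hn
  have h1 : tailRatio n j ≤ ∏ l ∈ Finset.range j, exp (-(((j : ℝ) - l) / n)) := by
    refine Finset.prod_le_prod (fun l hl => div_nonneg ?_ ?_) fun l hl => ?_
    · exact sub_nonneg.2 (by exact_mod_cast h)
    · exact sub_nonneg.2 (by rw [Finset.mem_range] at hl; exact_mod_cast (hl.le.trans h))
    · rw [Finset.mem_range] at hl
      have hlj : (l : ℝ) < j := by exact_mod_cast hl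
      have hjn : (j : ℝ) ≤ n := by exact_mod_cast h
      have hl0 : (0 : ℝ) ≤ l := Nat.cast_nonneg l
      have e1 : ((n : ℝ) - j) / (n - l) = 1 - (j - l) / (n - l) := by
        have : (n : ℝ) - l ≠ 0 := by linarith
        field_simp
        ring
      have e2 : ((j : ℝ) - l) / n ≤ (j - l) / (n - l) :=
        div_le_div_of_nonneg_left (by linarith) (by linarith) (by linarith)
      have e3 := add_one_le_exp (-(((j : ℝ) - l) / n))
      rw [e1]
      linarith
  refine h1.trans ?_
  rw [← exp_sum, exp_le_exp, Finset.sum_neg_distrib, neg_le_neg_iff, ← Finset.sum_div,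
    div_le_div_iff₀ (by positivity) hn']
  have h2 : ∀ m : ℕ, 2 * ∑ l ∈ Finset.range m, ((j : ℝ) - l) = 2 * j * m - m ^ 2 + m := by
    intro m
    induction m with
    | zero => simp
    | succ m ih =>
      rw [Finset.sum_range_succ, mul_add, ih]
      push_cast
      ring
  have h3 := h2 j
  have hj0 : (0 : ℝ) ≤ j := Nat.cast_nonneg j
  nlinarith [mul_nonneg hj0 hn'.le]

lemma abs_log_one_sub_add_cubic_le {y : ℝ} (h0 : 0 ≤ y) (h1 : y ≤ 1 / 2) :
    |log (1 - y) + (y + y ^ 2 / 2 + y ^ 3 / 3)| ≤ 2 * y ^ 4 := by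
  have h := abs_log_sub_add_sum_range_le (x := y) (by rw [abs_of_nonneg h0]; linarith) 3
  rw [abs_of_nonneg h0] at h
  norm_num [Finset.sum_range_succ] at h
  rw [add_comm]
  refine h.trans ?_
  rw [div_le_iff₀ (by linarith)]
  have : 0 ≤ y ^ 4 := by positivity
  nlinarith

lemma sum_range_cubic (c : ℝ) (j : ℕ) :
    ∑ l ∈ Finset.range j, ((l : ℝ) * c + ((l : ℝ) * c) ^ 2 / 2 + ((l : ℝ) * c) ^ 3 / 3) =
      ((j : ℝ) ^ 2 - j) / 2 * c + (2 * (j : ℝ) ^ 3 - 3 * (j : ℝ) ^ 2 + j) / 12 * c ^ 2 +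
        ((j : ℝ) ^ 4 - 2 * (j : ℝ) ^ 3 + (j : ℝ) ^ 2) / 12 * c ^ 3 := by
  induction j with
  | zero => simp
  | succ j ih =>
    rw [Finset.sum_range_succ, ih]
    push_cast
    ring

lemma tailRatio_eq_exp {n j : ℕ} (hn : 1 ≤ n) (h : 2 * j ≤ n) :
    tailRatio n j = exp (j * log (1 - (j : ℝ) * (n : ℝ)⁻¹) -
      ∑ l ∈ Finset.range j, log (1 - (l : ℝ) * (n : ℝ)⁻¹)) := by
  have hn' : (0 : ℝ) < n := by exact_mod_cast hn
  have hpos : ∀ l ≤ j, 0 < 1 - (l : ℝ) * (n : ℝ)⁻¹ := fun l hl => by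
    have : (l : ℝ) < n := by exact_mod_cast (by omega : l < n)
    rw [← div_eq_mul_inv, sub_pos, div_lt_one hn']
    exact this
  have h1 : (j : ℝ) * log (1 - (j : ℝ) * (n : ℝ)⁻¹) =
      ∑ l ∈ Finset.range j, log (1 - (j : ℝ) * (n : ℝ)⁻¹) := by simp
  rw [h1, ← Finset.sum_sub_distrib, exp_sum]
  refine Finset.prod_congr rfl fun l hl => ?_
  rw [Finset.mem_range] at hl
  rw [exp_sub, exp_log (hpos j le_rfl), exp_log (hpos l hl.le)]
  have h2 : (n : ℝ) - l ≠ 0 := by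
    have : (l : ℝ) < n := by exact_mod_cast (by omega : l < n)
    linarith
  have h3 : 1 - (l : ℝ) * (n : ℝ)⁻¹ ≠ 0 := (hpos l hl.le).ne'
  rw [div_eq_div_iff h2 h3]
  field_simp

/-- The logarithms are expanded to third order and the power sums evaluated at `j = x / h`. The
constant is `5 = 1 + 2 + 2`: the explicit `h ^ 3` terms and two contributions of the quartic
remainders. -/
lemma abs_tailExponent_sub_le {n j : ℕ} {h x : ℝ} (hn : 1 ≤ n) (hj : 2 * j ≤ n) (h0 : 0 < h)
    (hh : h ^ 2 * n = 1) (hx : x = h * j) :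
    |(j * log (1 - (j : ℝ) * (n : ℝ)⁻¹) - ∑ l ∈ Finset.range j, log (1 - (l : ℝ) * (n : ℝ)⁻¹)
        + x ^ 2 / 2) - (h * -(x / 2 + x ^ 3 / 3) + h ^ 2 * -((x ^ 2 + x ^ 4) / 4))| ≤
      5 * h ^ 3 * (1 + x) ^ 5 := by
  have hn' : (1 : ℝ) ≤ n := by exact_mod_cast hn
  have hc : (n : ℝ)⁻¹ = h ^ 2 := inv_eq_of_mul_eq_one_left hh
  have hh1 : h ≤ 1 := by
    by_contra hcon
    nlinarith
  have hj' : 2 * (j : ℝ) ≤ n := by exact_mod_cast hj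
  have hx0 : 0 ≤ x := hx ▸ mul_nonneg h0.le (Nat.cast_nonneg j)
  rw [hc]
  set e : ℕ → ℝ := fun l => log (1 - (l : ℝ) * h ^ 2) +
    ((l : ℝ) * h ^ 2 + ((l : ℝ) * h ^ 2) ^ 2 / 2 + ((l : ℝ) * h ^ 2) ^ 3 / 3) with he
  have hle : ∀ l ≤ j, |e l| ≤ 2 * (h * x) ^ 4 := fun l hl => by
    have hl' : (l : ℝ) ≤ j := by exact_mod_cast hl
    have hl0 : (0 : ℝ) ≤ l := Nat.cast_nonneg l
    refine (abs_log_one_sub_add_cubic_le (by positivity) (by nlinarith)).trans ?_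
    have : (l : ℝ) * h ^ 2 ≤ h * x := by rw [hx]; nlinarith [sq_nonneg h]
    gcongr
  have hlog : ∀ l : ℕ, log (1 - (l : ℝ) * h ^ 2) = e l -
      ((l : ℝ) * h ^ 2 + ((l : ℝ) * h ^ 2) ^ 2 / 2 + ((l : ℝ) * h ^ 2) ^ 3 / 3) := fun l => by
    rw [he]; ring
  have hmain : (j * log (1 - (j : ℝ) * h ^ 2) - ∑ l ∈ Finset.range j, log (1 - (l : ℝ) * h ^ 2)
        + x ^ 2 / 2) - (h * -(x / 2 + x ^ 3 / 3) + h ^ 2 * -((x ^ 2 + x ^ 4) / 4)) =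
      h ^ 3 * (x / 12 - x ^ 3 / 6 + h * x ^ 2 / 12) +
        (j * e j - ∑ l ∈ Finset.range j, e l) := by
    simp_rw [hlog, Finset.sum_sub_distrib]
    rw [sum_range_cubic, hx]
    ring
  have hsum : |∑ l ∈ Finset.range j, e l| ≤ j * (2 * (h * x) ^ 4) := by
    refine (Finset.abs_sum_le_sum_abs _ _).trans ?_
    refine (Finset.sum_le_sum fun l hl => hle l (Finset.mem_range.1 hl).le).trans ?_
    simp
  have hje : |(j : ℝ) * e j| ≤ j * (2 * (h * x) ^ 4) := by
    rw [abs_mul, Nat.abs_cast]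
    exact mul_le_mul_of_nonneg_left (hle j le_rfl) (Nat.cast_nonneg j)
  have hjx : (j : ℝ) * (2 * (h * x) ^ 4) = h ^ 3 * (2 * x ^ 5) := by
    rw [hx]; ring
  have hpoly : |h ^ 3 * (x / 12 - x ^ 3 / 6 + h * x ^ 2 / 12)| ≤ h ^ 3 * (1 + x) ^ 5 := by
    rw [abs_mul, abs_of_pos (pow_pos h0 3)]
    refine mul_le_mul_of_nonneg_left ?_ (pow_pos h0 3).le
    have a1 : h * x ^ 2 ≤ x ^ 2 := mul_le_of_le_one_left (sq_nonneg x) hh1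
    have a2 : 0 ≤ h * x ^ 2 := by positivity
    have a3 : (1 + x) ^ 5 = 1 + 5 * x + 10 * x ^ 2 + 10 * x ^ 3 + 5 * x ^ 4 + x ^ 5 := by ring
    have a4 : 0 ≤ x ^ 3 := by positivity
    have a5 : 0 ≤ x ^ 4 := by positivity
    have a6 : 0 ≤ x ^ 5 := by positivity
    rw [abs_le]
    constructor <;> linarith
  have hx5 : x ^ 5 ≤ (1 + x) ^ 5 := pow_le_pow_left₀ hx0 (by linarith) 5
  have hx5' : h ^ 3 * x ^ 5 ≤ h ^ 3 * (1 + x) ^ 5 :=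
    mul_le_mul_of_nonneg_left hx5 (pow_pos h0 3).le
  rw [hmain]
  rw [hjx] at hsum hje
  calc _ ≤ |h ^ 3 * (x / 12 - x ^ 3 / 6 + h * x ^ 2 / 12)| +
        (|(j : ℝ) * e j| + |∑ l ∈ Finset.range j, e l|) :=
        (abs_add_le _ _).trans (add_le_add le_rfl (abs_sub _ _))
    _ ≤ _ := by linarith

/-- For `2 j ≤ n` the ratio is `exp (-x ^ 2 / 2) * exp u` with `u = h p + h ^ 2 b + δ`. The bound
`tailRatio_le_exp` forces `u ≤ 0`, so the quadratic Taylor bound applies for every `x`. For `2 j >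
n` no approximation is needed, since `1 ≤ 2 h (1 + x)` pays for the factor `h ^ 3`. -/
lemma abs_tailRatio_sub_le {n : ℕ} (hn : 1 ≤ n) (j : ℕ) {h x : ℝ} (h0 : 0 < h)
    (hh : h ^ 2 * n = 1) (hx : x = h * j) :
    |tailRatio n j - exp (-x ^ 2 / 2) * (1 + h * -(x / 2 + x ^ 3 / 3) +
        h ^ 2 * (-x ^ 2 / 8 - x ^ 4 / 12 + x ^ 6 / 18))| ≤
      1100 * h ^ 3 * (1 + x) ^ 15 * exp (-x ^ 2 / 2) := by
  have hn' : (1 : ℝ) ≤ n := by exact_mod_cast hn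
  have hh1 : h ≤ 1 := by
    by_contra hcon
    nlinarith
  have hx0 : 0 ≤ x := hx ▸ mul_nonneg h0.le (Nat.cast_nonneg j)
  have hxj : -((j : ℝ) ^ 2 / (2 * n)) = -x ^ 2 / 2 := by
    rw [hx]
    have : (n : ℝ) ≠ 0 := by linarith
    field_simp
    linear_combination ((j : ℝ) ^ 2) * hh
  set w := 1 + x with hw
  have hw1 : 1 ≤ w := by linarith
  have hxw : x ≤ w := by linarith
  have hxp : ∀ k m : ℕ, k ≤ m → x ^ k ≤ w ^ m := fun k m hkm =>
    (pow_le_pow_left₀ hx0 hxw k).trans (pow_le_pow_right₀ hw1 hkm)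
  have hwp : ∀ k m : ℕ, k ≤ m → w ^ k ≤ w ^ m := fun k m hkm => pow_le_pow_right₀ hw1 hkm
  have hE := exp_pos (-x ^ 2 / 2)
  have hx2 : 0 ≤ x ^ 2 := by positivity
  have hx3 : 0 ≤ x ^ 3 := by positivity
  have hx4 : 0 ≤ x ^ 4 := by positivity
  have hx6 : 0 ≤ x ^ 6 := by positivity
  rcases le_or_gt (2 * j) n with hj | hj
  · have hδ := abs_tailExponent_sub_le hn hj h0 hh hx
    have hle := tailRatio_le_exp (n := n) (j := j) (by omega)
    have hq := tailRatio_eq_exp hn hj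
    rw [hxj] at hle
    set v := (j : ℝ) * log (1 - (j : ℝ) * (n : ℝ)⁻¹) -
      ∑ l ∈ Finset.range j, log (1 - (l : ℝ) * (n : ℝ)⁻¹) with hv
    set u := v + x ^ 2 / 2 with hu
    have hvu : v = -x ^ 2 / 2 + u := by rw [hu]; ring
    have hu0 : u ≤ 0 := by
      rw [hq, exp_le_exp] at hle
      linarith
    rw [hq, hvu, exp_add, ← mul_sub, abs_mul, abs_of_pos hE, mul_comm]
    refine mul_le_mul_of_nonneg_right ?_ hE.le
    set p := -(x / 2 + x ^ 3 / 3) with hp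
    set b := -((x ^ 2 + x ^ 4) / 4) with hb
    have hp2 : -x ^ 2 / 8 - x ^ 4 / 12 + x ^ 6 / 18 = b + p ^ 2 / 2 := by
      rw [hp, hb]; ring
    set δ := u - (h * p + h ^ 2 * b) with hδdef
    have huδ : u = h * p + h ^ 2 * b + δ := by rw [hδdef]; ring
    have hpw : |p| ≤ w ^ 5 := by
      rw [hp, abs_neg, abs_of_nonneg (by positivity)]
      have := hxp 1 5 (by norm_num)
      have := hxp 3 5 (by norm_num)
      have : 0 ≤ w ^ 5 := by positivity
      rw [pow_one] at *
      linarith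
    have hbw : |b| ≤ w ^ 5 := by
      rw [hb, abs_neg, abs_of_nonneg (by positivity)]
      have := hxp 2 5 (by norm_num)
      have := hxp 4 5 (by norm_num)
      linarith
    have hw5 : 1 ≤ w ^ 5 := one_le_pow₀ hw1
    have hh2 : h ^ 2 ≤ h := by nlinarith
    have hh3 : h ^ 3 ≤ h ^ 2 := by
      have : h ^ 3 = h ^ 2 * h := by ring
      nlinarith [sq_nonneg h]
    have A1 : |h * p| ≤ h * w ^ 5 := by
      rw [abs_mul, abs_of_pos h0]
      exact mul_le_mul_of_nonneg_left hpw h0.le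
    have A2 : |h ^ 2 * b| ≤ h ^ 2 * w ^ 5 := by
      rw [abs_mul, abs_of_pos (pow_pos h0 2)]
      exact mul_le_mul_of_nonneg_left hbw (pow_pos h0 2).le
    have A2' : h ^ 2 * w ^ 5 ≤ h * w ^ 5 := mul_le_mul_of_nonneg_right hh2 (by positivity)
    have A3 : h ^ 3 * w ^ 5 ≤ h ^ 2 * w ^ 5 := mul_le_mul_of_nonneg_right hh3 (by positivity)
    have B1 : |u - h * p| ≤ 6 * h ^ 2 * w ^ 5 := by
      have : u - h * p = h ^ 2 * b + δ := by rw [huδ]; ring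
      rw [this]
      refine (abs_add_le _ _).trans ?_
      linarith
    have B2 : |u| ≤ 7 * h * w ^ 5 := by
      have : u = h * p + (u - h * p) := by ring
      rw [this]
      refine (abs_add_le _ _).trans ?_
      linarith
    have B3 : |u + h * p| ≤ 8 * h * w ^ 5 := (abs_add_le _ _).trans (by linarith)
    have B4 : |(u - h * p) * (u + h * p)| ≤ 48 * h ^ 3 * w ^ 10 := by
      rw [abs_mul]
      calc _ ≤ (6 * h ^ 2 * w ^ 5) * (8 * h * w ^ 5) :=
            mul_le_mul B1 B3 (abs_nonneg _) (by positivity)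
        _ = _ := by ring
    have B5 : |u| ^ 3 ≤ 343 * h ^ 3 * w ^ 15 := by
      calc |u| ^ 3 ≤ (7 * h * w ^ 5) ^ 3 := pow_le_pow_left₀ (abs_nonneg _) B2 3
        _ = _ := by ring
    have C1 := abs_exp_sub_quadratic_le hu0
    have C2 : exp u - (1 + h * p + h ^ 2 * (b + p ^ 2 / 2)) =
        (exp u - (1 + u + u ^ 2 / 2)) + (δ + (u - h * p) * (u + h * p) / 2) := by
      rw [hδdef]; ring
    rw [hp2, C2]
    have D1 : h ^ 3 * w ^ 5 ≤ h ^ 3 * w ^ 15 :=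
      mul_le_mul_of_nonneg_left (hwp 5 15 (by norm_num)) (pow_pos h0 3).le
    have D2 : h ^ 3 * w ^ 10 ≤ h ^ 3 * w ^ 15 :=
      mul_le_mul_of_nonneg_left (hwp 10 15 (by norm_num)) (pow_pos h0 3).le
    have D3 : |(u - h * p) * (u + h * p) / 2| = |(u - h * p) * (u + h * p)| / 2 := by
      rw [abs_div]; norm_num
    refine (abs_add_le _ _).trans ?_
    -- The constants add up to `3 * 343 + 48 / 2 + 5 = 1058 ≤ 1100`.
    have D4 := abs_add_le δ ((u - h * p) * (u + h * p) / 2)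
    have D5 : 0 ≤ h ^ 3 * w ^ 15 := by positivity
    linarith
  · have hj' : (n : ℝ) < 2 * j := by exact_mod_cast hj
    have hhx : 1 ≤ 2 * h * w := by
      have : 1 ≤ 2 * h * x := by rw [hx]; nlinarith [sq_pos_of_pos h0]
      nlinarith
    have hq : |tailRatio n j| ≤ exp (-x ^ 2 / 2) := by
      rcases le_or_gt j n with h1 | h1
      · rw [abs_of_nonneg (tailRatio_nonneg h1), ← hxj]
        exact tailRatio_le_exp h1
      · rw [tailRatio_eq_zero h1, abs_zero]
        exact hE.le
    have hw6 : 1 ≤ w ^ 6 := one_le_pow₀ hw1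
    have hp : |1 + h * -(x / 2 + x ^ 3 / 3) + h ^ 2 * (-x ^ 2 / 8 - x ^ 4 / 12 + x ^ 6 / 18)| ≤
        3 * w ^ 6 := by
      have e1 := hxp 1 6 (by norm_num)
      have e2 := hxp 2 6 (by norm_num)
      have e3 := hxp 3 6 (by norm_num)
      have e4 := hxp 4 6 (by norm_num)
      have e6 := hxp 6 6 (by norm_num)
      rw [pow_one] at e1
      have f1 : |h * -(x / 2 + x ^ 3 / 3)| ≤ w ^ 6 := by
        rw [abs_mul, abs_of_pos h0, abs_neg, abs_of_nonneg (by positivity)]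
        refine (mul_le_of_le_one_left (by positivity) hh1).trans ?_
        linarith
      have f2 : |h ^ 2 * (-x ^ 2 / 8 - x ^ 4 / 12 + x ^ 6 / 18)| ≤ w ^ 6 := by
        rw [abs_mul, abs_of_pos (pow_pos h0 2)]
        refine (mul_le_of_le_one_left (abs_nonneg _) (pow_le_one₀ h0.le hh1)).trans ?_
        rw [abs_le]
        constructor <;> linarith
      refine (abs_add_le _ _).trans ?_
      have := abs_add_le 1 (h * -(x / 2 + x ^ 3 / 3))
      rw [abs_one] at this
      linarith
    have hcube : 1 ≤ (2 * h * w) ^ 3 := one_le_pow₀ hhx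
    have hfin : 4 * w ^ 6 ≤ 1100 * h ^ 3 * w ^ 15 := by
      calc 4 * w ^ 6 ≤ 4 * w ^ 6 * (2 * h * w) ^ 3 := le_mul_of_one_le_right (by positivity) hcube
        _ = 32 * h ^ 3 * w ^ 9 := by ring
        _ ≤ 1100 * h ^ 3 * w ^ 15 := by
          have : h ^ 3 * w ^ 9 ≤ h ^ 3 * w ^ 15 :=
            mul_le_mul_of_nonneg_left (hwp 9 15 (by norm_num)) (pow_pos h0 3).le
          have : 0 ≤ h ^ 3 * w ^ 9 := by positivity
          linarith
    refine (abs_sub _ _).trans ?_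
    rw [abs_mul, abs_of_pos hE]
    have g1 := mul_le_mul_of_nonneg_left hp hE.le
    have g2 := mul_le_mul_of_nonneg_right hfin hE.le
    have g3 := mul_le_mul_of_nonneg_right hw6 hE.le
    linarith

end TailRatioEstimate

/-! ### Euler–Maclaurin summation -/

section EulerMaclaurin

open MeasureTheory intervalIntegral

/-- Repeated integration by parts against rescaled Bernoulli polynomials `k₁`, `k₂`, `k₃`, each the
derivative of the next. At both ends `k₃` vanishes and `k₂ = h ^ 2 / 12`, while `k₁ = ∓h / 2`; this
leaves the trapezoid and derivative terms. -/
lemma norm_integral_sub_trapezoid_le {f f₁ f₂ f₃ : ℝ → ℂ} (h1 : ∀ x, HasDerivAt f (f₁ x) x)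
    (h2 : ∀ x, HasDerivAt f₁ (f₂ x) x) (h3 : ∀ x, HasDerivAt f₂ (f₃ x) x)
    (hc : Continuous f₃) (y : ℝ) {h : ℝ} (hh : 0 ≤ h) :
    ‖h / 2 * (f y + f (y + h)) - h ^ 2 / 12 * (f₁ (y + h) - f₁ y) - ∫ x in y..(y + h), f x‖ ≤
      h ^ 3 * ∫ x in y..(y + h), ‖f₃ x‖ := by
  set k₁ : ℝ → ℝ := fun x => (x - y) - h / 2 with hk1
  set k₂ : ℝ → ℝ := fun x => (x - y) ^ 2 / 2 - h * (x - y) / 2 + h ^ 2 / 12 with hk2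
  set k₃ : ℝ → ℝ := fun x => (x - y) ^ 3 / 6 - h * (x - y) ^ 2 / 4 + h ^ 2 * (x - y) / 12 with hk3
  have d0 : ∀ x : ℝ, HasDerivAt (fun x : ℝ => x - y) 1 x := fun x => (hasDerivAt_id x).sub_const y
  have d1 : ∀ x, HasDerivAt (fun x => (k₁ x : ℂ)) ((1 : ℝ) : ℂ) x := fun x =>
    ((d0 x).sub_const _).ofReal_comp
  have d2 : ∀ x, HasDerivAt (fun x => (k₂ x : ℂ)) ((k₁ x : ℝ) : ℂ) x := fun x => by
    refine HasDerivAt.ofReal_comp (f := k₂) ?_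
    refine (((((d0 x).pow 2).div_const 2).sub (((d0 x).const_mul h).div_const 2)).add_const
      (h ^ 2 / 12)).congr_deriv ?_
    simp only [hk1]
    ring
  have d3 : ∀ x, HasDerivAt (fun x => (k₃ x : ℂ)) ((k₂ x : ℝ) : ℂ) x := fun x => by
    refine HasDerivAt.ofReal_comp (f := k₃) ?_
    refine (((((d0 x).pow 3).div_const 6).sub ((((d0 x).pow 2).const_mul h).div_const 4)).add
      (((d0 x).const_mul (h ^ 2)).div_const 12)).congr_deriv ?_
    simp only [hk2]
    ring
  have dH : ∀ x, HasDerivAt (fun x => (k₃ x : ℂ) * f₂ x - k₂ x * f₁ x + k₁ x * f x)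
      (k₃ x * f₃ x + f x) x := fun x => by
    refine ((((d3 x).mul (h3 x)).sub ((d2 x).mul (h2 x))).add ((d1 x).mul (h1 x))).congr_deriv ?_
    push_cast
    ring
  have cf : Continuous f := continuous_iff_continuousAt.2 fun x => (h1 x).continuousAt
  have ck : Continuous fun x => (k₃ x : ℂ) :=
    continuous_iff_continuousAt.2 fun x => (d3 x).continuousAt
  have hint := integral_eq_sub_of_hasDerivAt (a := y) (b := y + h) (fun x _ => dH x)
    (((ck.mul hc).add cf).intervalIntegrable _ _)
  rw [integral_add (f := fun x => (k₃ x : ℂ) * f₃ x) ((ck.mul hc).intervalIntegrable _ _)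
    (cf.intervalIntegrable _ _)] at hint
  have hval : h / 2 * (f y + f (y + h)) - h ^ 2 / 12 * (f₁ (y + h) - f₁ y) -
      ∫ x in y..(y + h), f x = ∫ x in y..(y + h), (k₃ x : ℂ) * f₃ x := by
    simp only [hk1, hk2, hk3] at hint ⊢
    push_cast at hint ⊢
    linear_combination (-1 : ℂ) * hint
  rw [hval, ← intervalIntegral.integral_const_mul]
  refine (intervalIntegral.norm_integral_le_integral_norm (by linarith)).trans ?_
  refine integral_mono_on (by linarith) ((ck.mul hc).norm.intervalIntegrable _ _)
    ((continuous_const.mul hc.norm).intervalIntegrable _ _) fun x hx => ?_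
  rw [norm_mul]
  refine mul_le_mul_of_nonneg_right ?_ (norm_nonneg _)
  rw [Complex.norm_real, Real.norm_eq_abs]
  obtain ⟨hx1, hx2⟩ := hx
  have e1 : 0 ≤ x - y := by linarith
  have e2 : x - y ≤ h := by linarith
  have e3 : (x - y) ^ 3 ≤ h ^ 3 := pow_le_pow_left₀ e1 e2 3
  have e4 : h * (x - y) ^ 2 ≤ h * h ^ 2 :=
    mul_le_mul_of_nonneg_left (pow_le_pow_left₀ e1 e2 2) hh
  have e5 : h ^ 2 * (x - y) ≤ h ^ 2 * h := mul_le_mul_of_nonneg_left e2 (sq_nonneg h)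
  have e6 : 0 ≤ (x - y) ^ 3 := by positivity
  have e7 : 0 ≤ h * (x - y) ^ 2 := by positivity
  have e8 : 0 ≤ h ^ 2 * (x - y) := by positivity
  have e9 : h * h ^ 2 = h ^ 3 := by ring
  have e10 : h ^ 2 * h = h ^ 3 := by ring
  simp only [hk3]
  rw [abs_le]
  constructor <;> linarith

/-- The Euler–Maclaurin formula with an error term of the third order. -/
lemma norm_sum_sub_integral_le {f f₁ f₂ f₃ : ℝ → ℂ} (h1 : ∀ x, HasDerivAt f (f₁ x) x)
    (h2 : ∀ x, HasDerivAt f₁ (f₂ x) x) (h3 : ∀ x, HasDerivAt f₂ (f₃ x) x)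
    (hc : Continuous f₃) {h : ℝ} (hh : 0 ≤ h) (N : ℕ) :
    ‖h * ∑ j ∈ Finset.range N, f (h * (j + 1 : ℕ)) - ((∫ x in 0..(h * N), f x) -
        h / 2 * (f 0 - f (h * N)) + h ^ 2 / 12 * (f₁ (h * N) - f₁ 0))‖ ≤
      h ^ 3 * ∫ x in 0..(h * N), ‖f₃ x‖ := by
  have cf : Continuous f := continuous_iff_continuousAt.2 fun x => (h1 x).continuousAt
  induction N with
  | zero => simp
  | succ N ih =>
    have hN : h * ((N + 1 : ℕ) : ℝ) = h * N + h := by push_cast; ring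
    have loc := norm_integral_sub_trapezoid_le h1 h2 h3 hc (h * N) hh
    rw [Finset.sum_range_succ, hN,
      ← integral_add_adjacent_intervals (cf.intervalIntegrable 0 (h * N))
        (cf.intervalIntegrable (h * N) (h * N + h)),
      ← integral_add_adjacent_intervals (hc.norm.intervalIntegrable 0 (h * N))
        (hc.norm.intervalIntegrable (h * N) (h * N + h)), mul_add (h ^ 3)]
    refine le_trans (le_of_eq (congrArg norm ?_)) ((norm_add_le _ _).trans (add_le_add ih loc))
    ring

end EulerMaclaurin

/-! ### Half-line integrals and Riemann sums of polynomials times Gaussians -/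

section GaussianPolynomials

open MeasureTheory Polynomial

/-- The product of a polynomial with the function `exp (-x ^ 2 / 2 + i t x)`. -/
noncomputable def gaussianPoly (t : ℝ) (p : ℂ[X]) (x : ℝ) : ℂ :=
  p.eval (x : ℂ) * Complex.exp (-(x : ℂ) ^ 2 / 2 + Complex.I * t * x)

/-- The polynomial factor of the derivative of `gaussianPoly t p`. -/
noncomputable def gaussianPolyDeriv (t : ℝ) (p : ℂ[X]) : ℂ[X] :=
  derivative p + (C (Complex.I * t) - X) * p

/-- The integral of `gaussianPoly t p` over the positive half-line. -/
noncomputable def halfMoment (t : ℝ) (p : ℂ[X]) : ℂ := ∫ x in Set.Ioi (0 : ℝ), gaussianPoly t p x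

lemma hasDerivAt_gaussianPoly (t : ℝ) (p : ℂ[X]) (x : ℝ) :
    HasDerivAt (gaussianPoly t p) (gaussianPoly t (gaussianPolyDeriv t p) x) x := by
  have h1 : HasDerivAt (fun x : ℝ => (x : ℂ)) 1 x := Complex.ofRealCLM.hasDerivAt
  have h2 : HasDerivAt (fun x : ℝ => p.eval (x : ℂ)) ((derivative p).eval (x : ℂ)) x := by
    simpa using (p.hasDerivAt (x : ℂ)).comp_ofReal
  have h3 := ((((h1.pow 2).neg).div_const 2).add (h1.const_mul (Complex.I * t))).cexp
  refine (h2.mul h3).congr_deriv ?_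
  simp only [gaussianPoly, gaussianPolyDeriv, eval_add, eval_mul, eval_sub, eval_C, eval_X,
    Pi.add_apply, Pi.neg_apply, Pi.pow_apply]
  push_cast
  ring

lemma continuous_gaussianPoly (t : ℝ) (p : ℂ[X]) : Continuous (gaussianPoly t p) :=
  continuous_iff_continuousAt.2 fun x => (hasDerivAt_gaussianPoly t p x).continuousAt

lemma norm_gaussianPoly (t : ℝ) (p : ℂ[X]) (x : ℝ) :
    ‖gaussianPoly t p x‖ = ‖p.eval (x : ℂ)‖ * Real.exp (-x ^ 2 / 2) := by
  rw [gaussianPoly, norm_mul, Complex.norm_exp]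
  congr 2
  have : -(x : ℂ) ^ 2 / 2 + Complex.I * t * x = ((-x ^ 2 / 2 : ℝ) : ℂ) + ((t * x : ℝ) : ℂ) *
      Complex.I := by
    push_cast
    ring
  rw [this, Complex.add_re, Complex.ofReal_re, Complex.re_ofReal_mul, Complex.I_re, mul_zero,
    add_zero]

/-- Combines `x ^ k ≤ k! * exp x` with `x - x ^ 2 / 2 ≤ 2 - x`. Plain exponential decay suffices and
is easily summed. -/
lemma norm_eval_mul_exp_le (p : ℂ[X]) :
    ∃ K : ℝ, 0 ≤ K ∧ ∀ x : ℝ, 0 ≤ x →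
      ‖p.eval (x : ℂ)‖ * Real.exp (-x ^ 2 / 2) ≤ K * Real.exp (-x) := by
  induction p using Polynomial.induction_on' with
  | add p q hp hq =>
    obtain ⟨K, hK, h1⟩ := hp
    obtain ⟨L, hL, h2⟩ := hq
    refine ⟨K + L, add_nonneg hK hL, fun x hx => ?_⟩
    have := norm_add_le (p.eval (x : ℂ)) (q.eval (x : ℂ))
    rw [eval_add]
    nlinarith [h1 x hx, h2 x hx, Real.exp_pos (-x ^ 2 / 2)]
  | monomial k c =>
    refine ⟨‖c‖ * (k.factorial * Real.exp 2), by positivity, fun x hx => ?_⟩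
    have h1 : x ^ k ≤ k.factorial * Real.exp x := by
      have := Real.pow_div_factorial_le_exp x hx k
      rwa [div_le_iff₀ (by positivity), mul_comm] at this
    have h2 : Real.exp x * Real.exp (-x ^ 2 / 2) ≤ Real.exp 2 * Real.exp (-x) := by
      rw [← Real.exp_add, ← Real.exp_add, Real.exp_le_exp]
      nlinarith [sq_nonneg (x - 2)]
    rw [eval_monomial, norm_mul, norm_pow, Complex.norm_real, Real.norm_of_nonneg hx, mul_assoc,
      mul_assoc]
    refine mul_le_mul_of_nonneg_left ?_ (norm_nonneg c)
    calc x ^ k * Real.exp (-x ^ 2 / 2) ≤ k.factorial * Real.exp x * Real.exp (-x ^ 2 / 2) :=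
          mul_le_mul_of_nonneg_right h1 (Real.exp_pos _).le
      _ ≤ _ := by
          rw [mul_assoc, mul_assoc]
          exact mul_le_mul_of_nonneg_left h2 (Nat.cast_nonneg _)

lemma norm_gaussianPoly_le (t : ℝ) (p : ℂ[X]) :
    ∃ K : ℝ, 0 ≤ K ∧ ∀ x : ℝ, 0 ≤ x → ‖gaussianPoly t p x‖ ≤ K * Real.exp (-x) := by
  simp only [norm_gaussianPoly]
  exact norm_eval_mul_exp_le p

lemma integrableOn_exp_neg : IntegrableOn (fun x : ℝ => Real.exp (-x)) (Set.Ioi 0) :=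
  integrableOn_exp_neg_Ioi 0

lemma integrableOn_gaussianPoly (t : ℝ) (p : ℂ[X]) :
    IntegrableOn (gaussianPoly t p) (Set.Ioi 0) := by
  obtain ⟨K, -, hK⟩ := norm_gaussianPoly_le t p
  refine (integrableOn_exp_neg.const_mul K).mono'
    (continuous_gaussianPoly t p).aestronglyMeasurable ?_
  exact (ae_restrict_mem measurableSet_Ioi).mono fun x hx => hK x (le_of_lt hx)

lemma tendsto_gaussianPoly (t : ℝ) (p : ℂ[X]) :
    Tendsto (gaussianPoly t p) atTop (nhds 0) := by
  obtain ⟨K, -, hK⟩ := norm_gaussianPoly_le t p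
  refine squeeze_zero_norm' ((eventually_ge_atTop 0).mono fun x hx => hK x hx) ?_
  have := (Real.tendsto_exp_neg_atTop_nhds_zero).const_mul K
  rwa [mul_zero] at this

lemma halfMoment_add (t : ℝ) (p q : ℂ[X]) :
    halfMoment t (p + q) = halfMoment t p + halfMoment t q := by
  unfold halfMoment
  rw [← integral_add (integrableOn_gaussianPoly t p) (integrableOn_gaussianPoly t q)]
  simp only [gaussianPoly, eval_add, add_mul]

lemma halfMoment_C_mul (t : ℝ) (c : ℂ) (p : ℂ[X]) :
    halfMoment t (C c * p) = c * halfMoment t p := by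
  unfold halfMoment
  rw [← integral_const_mul]
  simp only [gaussianPoly, eval_mul, eval_C, mul_assoc]

lemma halfMoment_gaussianPolyDeriv (t : ℝ) (p : ℂ[X]) :
    halfMoment t (gaussianPolyDeriv t p) = -p.eval 0 := by
  unfold halfMoment
  rw [integral_Ioi_of_hasDerivAt_of_tendsto' (fun x _ => hasDerivAt_gaussianPoly t p x)
    (integrableOn_gaussianPoly t _) (tendsto_gaussianPoly t p)]
  simp [gaussianPoly]

/-- Integration by parts for the half moments. -/
lemma halfMoment_X_pow_succ (t : ℝ) (k : ℕ) :
    halfMoment t (X ^ (k + 1)) = Complex.I * t * halfMoment t (X ^ k) +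
      k * halfMoment t (X ^ (k - 1)) + (0 : ℂ) ^ k := by
  -- For `k = 0` the truncated exponent `k - 1` carries the factor zero, and `0 ^ k = 1` is the
  -- boundary term.
  have h := halfMoment_gaussianPolyDeriv t (X ^ k)
  have h1 : gaussianPolyDeriv t (X ^ k) =
      C (k : ℂ) * X ^ (k - 1) + (C (Complex.I * t) * X ^ k + C (-1) * X ^ (k + 1)) := by
    rw [gaussianPolyDeriv, derivative_X_pow, C_neg, C_1]
    ring
  rw [h1, halfMoment_add, halfMoment_add, halfMoment_C_mul, halfMoment_C_mul, halfMoment_C_mul] at h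
  rw [eval_pow, eval_X] at h
  linear_combination -h

/-- The estimate `h ≤ exp h - 1` makes the sum telescope. Since the bound is uniform in `h` and `N`,
pointwise errors `O(h ^ 3 exp (-x))` sum to `O(h ^ 3)`. -/
lemma sum_mul_exp_neg_le {h : ℝ} (N : ℕ) :
    ∑ j ∈ Finset.range N, h * Real.exp (-(h * (j + 1 : ℕ))) ≤ 1 := by
  have h1 : ∀ j ∈ Finset.range N, h * Real.exp (-(h * (j + 1 : ℕ))) ≤
      Real.exp (-(h * (j : ℕ))) - Real.exp (-(h * (j + 1 : ℕ))) := fun j _ => by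
    have e1 : Real.exp (-(h * (j : ℕ))) = Real.exp h * Real.exp (-(h * (j + 1 : ℕ))) := by
      rw [← Real.exp_add]
      congr 1
      push_cast
      ring
    have e2 := Real.add_one_le_exp h
    have e3 := Real.exp_pos (-(h * (j + 1 : ℕ)))
    rw [e1]
    nlinarith
  refine (Finset.sum_le_sum h1).trans ?_
  rw [Finset.sum_range_sub']
  simp [Real.exp_nonneg]

lemma summable_mul_exp_neg {h : ℝ} (hh : 0 < h) :
    Summable fun j : ℕ => h * Real.exp (-(h * (j + 1 : ℕ))) :=
  summable_of_sum_range_le (fun _ => by positivity) sum_mul_exp_neg_le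

lemma tsum_mul_exp_neg_le {h : ℝ} (hh : 0 < h) :
    ∑' j : ℕ, h * Real.exp (-(h * (j + 1 : ℕ))) ≤ 1 :=
  Real.tsum_le_of_sum_range_le (fun _ => by positivity) sum_mul_exp_neg_le

lemma summable_gaussianPoly (t : ℝ) (p : ℂ[X]) {h : ℝ} (hh : 0 < h) :
    Summable fun j : ℕ => gaussianPoly t p (h * (j + 1 : ℕ)) := by
  obtain ⟨K, -, hK⟩ := norm_gaussianPoly_le t p
  refine Summable.of_norm_bounded ((summable_mul_exp_neg hh).mul_left (K / h)) fun j => ?_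
  refine (hK _ (by positivity)).trans (le_of_eq ?_)
  field_simp

/-- The limit `N → ∞` of Euler–Maclaurin: terms at the far end vanish, and the error integral is
bounded by that over the half-line. -/
lemma exists_norm_tsum_gaussianPoly_sub_le (t : ℝ) (p : ℂ[X]) :
    ∃ K : ℝ, 0 ≤ K ∧ ∀ h : ℝ, 0 < h →
      ‖h * ∑' j : ℕ, gaussianPoly t p (h * (j + 1 : ℕ)) -
        (halfMoment t p - h / 2 * p.eval 0 - h ^ 2 / 12 * (gaussianPolyDeriv t p).eval 0)‖ ≤
        K * h ^ 3 := by
  set q := gaussianPolyDeriv t (gaussianPolyDeriv t (gaussianPolyDeriv t p)) with hq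
  refine ⟨∫ x in Set.Ioi (0 : ℝ), ‖gaussianPoly t q x‖, integral_nonneg fun _ => norm_nonneg _,
    fun h hh => ?_⟩
  have hN : Tendsto (fun N : ℕ => h * (N : ℝ)) atTop atTop :=
    tendsto_natCast_atTop_atTop.const_mul_atTop hh
  have l1 := (summable_gaussianPoly t p hh).hasSum.tendsto_sum_nat.const_mul (h : ℂ)
  have l2 := intervalIntegral_tendsto_integral_Ioi 0 (integrableOn_gaussianPoly t p) hN
  have l3 := ((tendsto_gaussianPoly t p).comp hN).const_sub (gaussianPoly t p 0)
  have l4 := ((tendsto_gaussianPoly t (gaussianPolyDeriv t p)).comp hN).sub_const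
    (gaussianPoly t (gaussianPolyDeriv t p) 0)
  have lim := (l1.sub ((l2.sub (l3.const_mul ((h : ℂ) / 2))).add
    (l4.const_mul ((h : ℂ) ^ 2 / 12)))).norm
  have h0 : ∀ r : ℂ[X], gaussianPoly t r 0 = r.eval 0 := fun r => by simp [gaussianPoly]
  refine le_of_tendsto' (f := fun N : ℕ => _) (x := atTop) (b := _)
    (a := ‖h * ∑' j : ℕ, gaussianPoly t p (h * (j + 1 : ℕ)) -
        (halfMoment t p - h / 2 * p.eval 0 - h ^ 2 / 12 * (gaussianPolyDeriv t p).eval 0)‖)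
    (by
      convert lim using 2
      rw [h0, h0, halfMoment]
      ring_nf) fun N => ?_
  refine (norm_sum_sub_integral_le (hasDerivAt_gaussianPoly t p) (hasDerivAt_gaussianPoly t _)
    (hasDerivAt_gaussianPoly t _) (continuous_gaussianPoly t q) hh.le N).trans ?_
  rw [mul_comm]
  refine mul_le_mul_of_nonneg_right ?_ (by positivity)
  rw [intervalIntegral.integral_of_le (by positivity)]
  exact setIntegral_mono_set (integrableOn_gaussianPoly t q).norm
    (ae_of_all _ fun _ => norm_nonneg _) (LE.le.eventuallyLE Set.Ioc_subset_Ioi_self)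

end GaussianPolynomials

/-! ### The basic half moment and the normal distribution function -/

section HalfMomentOne

open MeasureTheory Polynomial

/-- Differentiation under the integral; the oscillating factor has modulus one, so the case `t = 0`
dominates for all `t`. -/
lemma hasDerivAt_halfMoment_one (t : ℝ) :
    HasDerivAt (fun t : ℝ => halfMoment t 1) (halfMoment t (C Complex.I * X)) t := by
  refine (hasDerivAt_integral_of_dominated_loc_of_deriv_le (μ := volume.restrict (Set.Ioi 0))
    (F := fun t x => gaussianPoly t 1 x) (F' := fun t x => gaussianPoly t (C Complex.I * X) x)
    (bound := fun x => ‖gaussianPoly 0 X x‖) (s := Set.univ) Filter.univ_mem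
    (Eventually.of_forall fun s => (continuous_gaussianPoly s 1).aestronglyMeasurable)
    (integrableOn_gaussianPoly t 1) (continuous_gaussianPoly t _).aestronglyMeasurable
    (ae_of_all _ fun x s _ => ?_) (integrableOn_gaussianPoly 0 X).norm
    (ae_of_all _ fun x s _ => ?_)).2
  · rw [norm_gaussianPoly, norm_gaussianPoly]
    simp
  · have h1 : HasDerivAt (fun s : ℝ => (s : ℂ)) 1 s := Complex.ofRealCLM.hasDerivAt
    have h2 := (((h1.const_mul Complex.I).mul_const (x : ℂ)).const_add (-(x : ℂ) ^ 2 / 2)).cexp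
    simp only [gaussianPoly, eval_one, one_mul, eval_mul, eval_C, eval_X]
    refine h2.congr_deriv ?_
    ring

lemma halfMoment_X (t : ℝ) : halfMoment t X = Complex.I * t * halfMoment t 1 + 1 := by
  simpa using halfMoment_X_pow_succ t 0

lemma halfMoment_zero_one : halfMoment 0 1 = ((√(2 * Real.pi) / 2 : ℝ) : ℂ) := by
  have h := integral_gaussian_Ioi (1 / 2)
  have h1 : Real.pi / (1 / 2) = 2 * Real.pi := by ring
  rw [h1] at h
  rw [← h, ← integral_complex_ofReal, halfMoment]
  refine integral_congr_ae (ae_of_all _ fun x => ?_)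
  simp only [gaussianPoly, eval_one, one_mul]
  push_cast
  congr 1
  ring

/-- Integration by parts gives `M' = -t M + i`; the integrating factor `exp (t ^ 2 / 2)` makes `F`
constant. -/
lemma halfMoment_one (t : ℝ) :
    halfMoment t 1 = Complex.exp (-(t : ℂ) ^ 2 / 2) * (((√(2 * Real.pi) / 2 : ℝ) : ℂ) +
      Complex.I * ((∫ u in (0 : ℝ)..t, Real.exp (u ^ 2 / 2) : ℝ) : ℂ)) := by
  set F : ℝ → ℂ := fun t => Complex.exp ((t : ℂ) ^ 2 / 2) * halfMoment t 1 -
    Complex.I * ((∫ u in (0 : ℝ)..t, Real.exp (u ^ 2 / 2) : ℝ) : ℂ) with hF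
  have hd : ∀ t, HasDerivAt F 0 t := fun t => by
    have h1 : HasDerivAt (fun s : ℝ => (s : ℂ)) 1 t := Complex.ofRealCLM.hasDerivAt
    have h2 := ((h1.pow 2).div_const 2).cexp
    have hc : Continuous fun u : ℝ => Real.exp (u ^ 2 / 2) := by fun_prop
    have h3 := ((intervalIntegral.integral_hasDerivAt_right (hc.intervalIntegrable 0 t)
      (hc.stronglyMeasurableAtFilter _ _) hc.continuousAt).ofReal_comp).const_mul Complex.I
    refine ((h2.mul (hasDerivAt_halfMoment_one t)).sub h3).congr_deriv ?_
    rw [halfMoment_C_mul, halfMoment_X]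
    simp only [Pi.pow_apply]
    push_cast
    ring_nf
    rw [Complex.I_sq]
    ring
  have hconst : F t = F 0 :=
    is_const_of_deriv_eq_zero (fun t => (hd t).differentiableAt) (fun t => (hd t).deriv) t 0
  have hE : Complex.exp (-(t : ℂ) ^ 2 / 2) * Complex.exp ((t : ℂ) ^ 2 / 2) = 1 := by
    rw [← Complex.exp_add, ← Complex.exp_zero]
    congr 1
    ring
  simp only [hF, halfMoment_zero_one] at hconst
  simp only [Complex.ofReal_zero, ne_eq, OfNat.ofNat_ne_zero, not_false_eq_true, zero_pow, zero_div,
    Complex.exp_zero, one_mul, intervalIntegral.integral_same, mul_zero, sub_zero] at hconst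
  linear_combination (Complex.exp (-(t : ℂ) ^ 2 / 2)) * hconst - halfMoment t 1 * hE

lemma re_halfMoment_one_ne_zero (t : ℝ) : (halfMoment t 1).re ≠ 0 := by
  have h1 : Complex.exp (-(t : ℂ) ^ 2 / 2) = ((Real.exp (-t ^ 2 / 2) : ℝ) : ℂ) := by
    push_cast
    rfl
  rw [halfMoment_one, h1, Complex.re_ofReal_mul, Complex.add_re, Complex.ofReal_re,
    Complex.re_mul_ofReal, Complex.I_re, zero_mul, add_zero]
  have := Real.pi_pos
  positivity

/-- Substitution `u = s t` on the imaginary axis, where the integrand of `erf` becomes real and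
growing. -/
lemma erf_I_mul_div_sqrt_two (t : ℝ) :
    erf (Complex.I * t / (√2 : ℝ)) = 2 / (√Real.pi : ℂ) * (Complex.I / (√2 : ℝ) *
      ((∫ u in (0 : ℝ)..t, Real.exp (u ^ 2 / 2) : ℝ) : ℂ)) := by
  have h2 : ((√2 : ℝ) : ℂ) ^ 2 = 2 := by
    rw [← Complex.ofReal_pow, Real.sq_sqrt (by norm_num)]
    norm_num
  have h1 : t * ∫ s in (0 : ℝ)..1, Real.exp ((s * t) ^ 2 / 2) =
      ∫ u in (0 : ℝ)..t, Real.exp (u ^ 2 / 2) := by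
    have := intervalIntegral.mul_integral_comp_mul_right (a := 0) (b := 1)
      (f := fun u => Real.exp (u ^ 2 / 2)) (c := t)
    simpa using this
  rw [erf, ← h1]
  congr 1
  rw [intervalIntegral.integral_const_mul, Complex.ofReal_mul,
    ← intervalIntegral.integral_ofReal, ← mul_assoc]
  congr 1
  · ring
  · refine intervalIntegral.integral_congr fun s _ => ?_
    push_cast
    congr 1
    rw [mul_pow, div_pow, mul_pow, Complex.I_sq, h2]
    ring

/-- The integral of `exp (-x ^ 2 / 2 + i t x)` over the positive half-line. -/
lemma halfMoment_one_eq_normalCDF (t : ℝ) :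
    halfMoment t 1 = (√(2 * Real.pi) : ℝ) * Complex.exp (-(t : ℂ) ^ 2 / 2) *
      normalCDF (Complex.I * t) := by
  rw [halfMoment_one, normalCDF, erf_I_mul_div_sqrt_two, Real.sqrt_mul (by norm_num)]
  have h2 : ((√2 : ℝ) : ℂ) ≠ 0 := by
    rw [Complex.ofReal_ne_zero]
    positivity
  have h3 : ((√Real.pi : ℝ) : ℂ) ≠ 0 := by
    rw [Complex.ofReal_ne_zero]
    have := Real.pi_pos
    positivity
  push_cast
  field_simp
  ring

end HalfMomentOne

/-! ### Expansions of the two factors -/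

section Expansion

open Polynomial

/-- The coefficient of order `n ^ (-1 / 2)` in the expansion of the tail probabilities. -/
noncomputable def tailPolyOne : ℂ[X] := C (-1 / 2) * X ^ 1 + C (-1 / 3) * X ^ 3

/-- The coefficient of order `n ^ (-1)` in the expansion of the tail probabilities. -/
noncomputable def tailPolyTwo : ℂ[X] :=
  C (-1 / 8) * X ^ 2 + C (-1 / 12) * X ^ 4 + C (1 / 18) * X ^ 6

lemma exists_norm_tailRatio_sub_le (t : ℝ) :
    ∃ K : ℝ, 0 ≤ K ∧ ∀ n : ℕ, 1 ≤ n → ∀ h : ℝ, 0 < h → h ^ 2 * n = 1 → ∀ j : ℕ,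
      ‖(tailRatio n j : ℂ) * Complex.exp (Complex.I * t * ((h * (j : ℝ) : ℝ) : ℂ)) -
        (gaussianPoly t 1 (h * j) + h * gaussianPoly t tailPolyOne (h * j) +
          h ^ 2 * gaussianPoly t tailPolyTwo (h * j))‖ ≤ K * h ^ 3 * Real.exp (-(h * j)) := by
  obtain ⟨K, hK0, hK⟩ := norm_eval_mul_exp_le ((1 + X) ^ 15)
  refine ⟨1100 * K, by positivity, fun n hn h h0 hh j => ?_⟩
  set x : ℝ := h * j with hx
  have hx0 : 0 ≤ x := by positivity
  have h1 := abs_tailRatio_sub_le hn j h0 hh hx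
  have h2 := hK x hx0
  have h3 : ‖((1 + X : ℂ[X]) ^ 15).eval (x : ℂ)‖ = (1 + x) ^ 15 := by
    rw [eval_pow, eval_add, eval_one, eval_X, norm_pow]
    have : (1 : ℂ) + x = ((1 + x : ℝ) : ℂ) := by push_cast; rfl
    rw [this, Complex.norm_real, Real.norm_of_nonneg (by linarith)]
  rw [h3] at h2
  have h4 : (tailRatio n j : ℂ) * Complex.exp (Complex.I * t * (x : ℂ)) -
        (gaussianPoly t 1 x + h * gaussianPoly t tailPolyOne x +
          h ^ 2 * gaussianPoly t tailPolyTwo x) =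
      ((tailRatio n j - Real.exp (-x ^ 2 / 2) * (1 + h * -(x / 2 + x ^ 3 / 3) +
        h ^ 2 * (-x ^ 2 / 8 - x ^ 4 / 12 + x ^ 6 / 18)) : ℝ) : ℂ) *
        Complex.exp (((t * x : ℝ) : ℂ) * Complex.I) := by
    have e1 : Complex.I * t * (x : ℂ) = ((t * x : ℝ) : ℂ) * Complex.I := by
      push_cast; ring
    simp only [gaussianPoly, tailPolyOne, tailPolyTwo, eval_add, eval_mul, eval_C, eval_pow, eval_X,
      eval_one, e1, Complex.exp_add]
    push_cast
    ring
  rw [h4, norm_mul, Complex.norm_exp_ofReal_mul_I, mul_one, Complex.norm_real, Real.norm_eq_abs]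
  refine h1.trans ?_
  calc _ = 1100 * h ^ 3 * ((1 + x) ^ 15 * Real.exp (-x ^ 2 / 2)) := by ring
    _ ≤ 1100 * h ^ 3 * (K * Real.exp (-x)) := mul_le_mul_of_nonneg_left h2 (by positivity)
    _ = _ := by ring

lemma exists_norm_sum_tailRatio_sub_le (t : ℝ) :
    ∃ K : ℝ, ∀ n : ℕ, 1 ≤ n → ∀ h : ℝ, 0 < h → h ^ 2 * n = 1 →
      ‖h * ∑ j ∈ Finset.range n, (tailRatio n (j + 1) : ℂ) *
          Complex.exp (Complex.I * t * ((h * ((j + 1 : ℕ) : ℝ) : ℝ) : ℂ)) -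
        (halfMoment t 1 + h * (halfMoment t tailPolyOne - 1 / 2) +
          h ^ 2 * (halfMoment t tailPolyTwo - Complex.I * t / 12))‖ ≤ K * h ^ 3 := by
  obtain ⟨K, hK0, hK⟩ := exists_norm_tailRatio_sub_le t
  obtain ⟨K₀, h00, hK₀⟩ := exists_norm_tsum_gaussianPoly_sub_le t 1
  obtain ⟨K₁, h10, hK₁⟩ := exists_norm_tsum_gaussianPoly_sub_le t tailPolyOne
  obtain ⟨K₂, h20, hK₂⟩ := exists_norm_tsum_gaussianPoly_sub_le t tailPolyTwo
  refine ⟨K + K₀ + K₁ + K₂ + 1, fun n hn h h0 hh => ?_⟩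
  have hn' : (1 : ℝ) ≤ n := by exact_mod_cast hn
  have hh1 : h ≤ 1 := by
    by_contra hcon
    nlinarith
  set f : ℕ → ℂ := fun j => (tailRatio n (j + 1) : ℂ) *
    Complex.exp (Complex.I * t * ((h * ((j + 1 : ℕ) : ℝ) : ℝ) : ℂ)) with hf
  set g : ℂ[X] → ℕ → ℂ := fun p j => gaussianPoly t p (h * (j + 1 : ℕ)) with hg
  -- The tail vanishes beyond `n`, so the finite sum is the full series.
  have hf0 : ∀ j ∉ Finset.range n, f j = 0 := fun j hj => by
    rw [Finset.mem_range, not_lt] at hj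
    simp only [hf, tailRatio_eq_zero (Nat.lt_succ_of_le hj), Complex.ofReal_zero, zero_mul]
  have hfs : Summable f := summable_of_ne_finset_zero hf0
  have hfsum : ∑' j, f j = ∑ j ∈ Finset.range n, f j := tsum_eq_sum hf0
  have gs : ∀ p, Summable (g p) := fun p => summable_gaussianPoly t p h0
  have T : ‖(h : ℂ) * ∑' j, f j - (h * ∑' j, g 1 j + h * (h * ∑' j, g tailPolyOne j) +
      h ^ 2 * (h * ∑' j, g tailPolyTwo j))‖ ≤ K * h ^ 3 := by
    have e1 : (h : ℂ) * ∑' j, f j - (h * ∑' j, g 1 j + h * (h * ∑' j, g tailPolyOne j) +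
        h ^ 2 * (h * ∑' j, g tailPolyTwo j)) =
        ∑' j, (h : ℂ) * (f j - (g 1 j + h * g tailPolyOne j + h ^ 2 * g tailPolyTwo j)) := by
      rw [tsum_mul_left, hfs.tsum_sub (((gs 1).add ((gs _).mul_left _)).add ((gs _).mul_left _)),
        ((gs 1).add ((gs _).mul_left _)).tsum_add ((gs _).mul_left _),
        (gs 1).tsum_add ((gs _).mul_left _), tsum_mul_left, tsum_mul_left]
      ring
    rw [e1]
    have hb := (summable_mul_exp_neg h0).mul_left (K * h ^ 3)
    refine (tsum_of_norm_bounded hb.hasSum fun j => ?_).trans ?_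
    · rw [norm_mul, Complex.norm_real, Real.norm_of_nonneg h0.le]
      refine (mul_le_mul_of_nonneg_left (hK n hn h h0 hh (j + 1)) h0.le).trans (le_of_eq ?_)
      ring
    · rw [tsum_mul_left]
      exact mul_le_of_le_one_right (by positivity) (tsum_mul_exp_neg_le h0)
  have E0 := hK₀ h h0
  have E1 := hK₁ h h0
  have E2 := hK₂ h h0
  have v0 : (1 : ℂ[X]).eval 0 = 1 := by simp
  have d0 : (gaussianPolyDeriv t 1).eval 0 = Complex.I * t := by simp [gaussianPolyDeriv]
  have v1 : tailPolyOne.eval 0 = 0 := by simp [tailPolyOne]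
  have d1 : (gaussianPolyDeriv t tailPolyOne).eval 0 = -1 / 2 := by
    simp [gaussianPolyDeriv, tailPolyOne]
  have v2 : tailPolyTwo.eval 0 = 0 := by simp [tailPolyTwo]
  have d2 : (gaussianPolyDeriv t tailPolyTwo).eval 0 = 0 := by
    simp [gaussianPolyDeriv, tailPolyTwo]
  rw [v0, d0] at E0
  rw [v1, d1] at E1
  rw [v2, d2] at E2
  rw [← hfsum]
  set A0 := (h : ℂ) * ∑' j, g 1 j - (halfMoment t 1 - h / 2 * 1 - h ^ 2 / 12 * (Complex.I * t))
  set A1 := (h : ℂ) * ∑' j, g tailPolyOne j -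
    (halfMoment t tailPolyOne - h / 2 * 0 - h ^ 2 / 12 * (-1 / 2))
  set A2 := (h : ℂ) * ∑' j, g tailPolyTwo j -
    (halfMoment t tailPolyTwo - h / 2 * 0 - h ^ 2 / 12 * 0)
  set A3 := (h : ℂ) * ∑' j, f j - (h * ∑' j, g 1 j + h * (h * ∑' j, g tailPolyOne j) +
      h ^ 2 * (h * ∑' j, g tailPolyTwo j))
  -- The derivative `-1 / 2` of `tailPolyOne` at zero contributes `h ^ 3 / 24`, which belongs to the
  -- error.
  have key : (h : ℂ) * ∑' j, f j - (halfMoment t 1 + h * (halfMoment t tailPolyOne - 1 / 2) +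
      h ^ 2 * (halfMoment t tailPolyTwo - Complex.I * t / 12)) =
      A3 + A0 + h * A1 + h ^ 2 * A2 + ((h ^ 3 / 24 : ℝ) : ℂ) := by
    simp only [A0, A1, A2, A3]
    push_cast
    ring
  rw [key]
  have hn3 : 0 ≤ h ^ 3 := by positivity
  have B1 : ‖(h : ℂ) * A1‖ ≤ K₁ * h ^ 3 := by
    rw [norm_mul, Complex.norm_real, Real.norm_of_nonneg h0.le]
    exact (mul_le_of_le_one_left (norm_nonneg _) hh1).trans E1
  have B2 : ‖(h : ℂ) ^ 2 * A2‖ ≤ K₂ * h ^ 3 := by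
    rw [norm_mul, norm_pow, Complex.norm_real, Real.norm_of_nonneg h0.le]
    exact (mul_le_of_le_one_left (norm_nonneg _) (pow_le_one₀ h0.le hh1)).trans E2
  have B3 : ‖((h ^ 3 / 24 : ℝ) : ℂ)‖ ≤ h ^ 3 := by
    rw [Complex.norm_real, Real.norm_of_nonneg (by positivity)]
    linarith
  have n1 := norm_add_le (A3 + A0 + h * A1 + h ^ 2 * A2) ((h ^ 3 / 24 : ℝ) : ℂ)
  have n2 := norm_add_le (A3 + A0 + h * A1) (h ^ 2 * A2)
  have n3 := norm_add_le (A3 + A0) (h * A1)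
  have n4 := norm_add_le A3 A0
  linarith

lemma isBigO_one_sub_exp_neg (z : ℂ) :
    (fun n : ℕ => (1 - Complex.exp (-(z * ((1 / √(n : ℝ) : ℝ) : ℂ)))) / ((1 / √(n : ℝ) : ℝ) : ℂ) -
      (z - z ^ 2 / 2 * ((1 / √(n : ℝ) : ℝ) : ℂ) + z ^ 3 / 6 * ((1 / √(n : ℝ) : ℝ) : ℂ) ^ 2))
      =O[atTop] (fun n : ℕ => (1 / √(n : ℝ)) ^ 3) := by
  have hlim : Tendsto (fun n : ℕ => ‖z‖ * (1 / √(n : ℝ))) atTop (nhds 0) := by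
    have : Tendsto (fun n : ℕ => 1 / √(n : ℝ)) atTop (nhds 0) := by
      simp only [one_div]
      exact (Real.tendsto_sqrt_atTop.comp tendsto_natCast_atTop_atTop).inv_tendsto_atTop
    simpa using this.const_mul ‖z‖
  refine IsBigO.of_bound (‖z‖ ^ 4) ?_
  filter_upwards [hlim.eventually_le_const one_pos, eventually_ge_atTop 1] with n hn1 hn
  have hpos : 0 < 1 / √(n : ℝ) := by
    have : (0 : ℝ) < n := by exact_mod_cast hn
    positivity
  set h : ℝ := 1 / √(n : ℝ)
  have hnorm : ‖-(z * (h : ℂ))‖ = ‖z‖ * h := by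
    rw [norm_neg, norm_mul, Complex.norm_real, Real.norm_of_nonneg hpos.le]
  have hb := Complex.exp_bound (x := -(z * (h : ℂ))) (by rw [hnorm]; exact hn1) (n := 4)
    (by norm_num)
  rw [hnorm] at hb
  norm_num [Finset.sum_range_succ, Nat.factorial] at hb
  have hne : (h : ℂ) ≠ 0 := Complex.ofReal_ne_zero.2 hpos.ne'
  set w := Complex.exp (-(z * (h : ℂ)))
  set s := w - (1 + -(z * h) + (z * h) ^ 2 / 2 + (-(z * h)) ^ 3 / 6) with hs
  have e1 : (1 - w) / (h : ℂ) - (z - z ^ 2 / 2 * h + z ^ 3 / 6 * (h : ℂ) ^ 2) = -s / h := by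
    rw [hs]
    field_simp
    ring
  rw [e1, norm_div, norm_neg, Complex.norm_real, Real.norm_of_nonneg hpos.le,
    Real.norm_of_nonneg (by positivity), div_le_iff₀ hpos]
  have h4 : 0 ≤ (‖z‖ * h) ^ 4 := by positivity
  calc ‖s‖ ≤ (‖z‖ * h) ^ 4 * (5 / 96) := hb
    _ ≤ (‖z‖ * h) ^ 4 := by linarith
    _ = _ := by ring

end Expansion

/-! ### The coefficient of `1 / n` and the final expansion -/

section FinalExpansion

open Polynomial

lemma halfMoment_X_pow_values (t : ℝ) :
    halfMoment t (X ^ 1) = Complex.I * t * halfMoment t 1 + 1 ∧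
    halfMoment t (X ^ 2) = ((Complex.I * t) ^ 2 + 1) * halfMoment t 1 + Complex.I * t ∧
    halfMoment t (X ^ 3) = ((Complex.I * t) ^ 3 + 3 * (Complex.I * t)) * halfMoment t 1 +
      (Complex.I * t) ^ 2 + 2 ∧
    halfMoment t (X ^ 4) = ((Complex.I * t) ^ 4 + 6 * (Complex.I * t) ^ 2 + 3) * halfMoment t 1 +
      (Complex.I * t) ^ 3 + 5 * (Complex.I * t) ∧
    halfMoment t (X ^ 6) = ((Complex.I * t) ^ 6 + 15 * (Complex.I * t) ^ 4 +
      45 * (Complex.I * t) ^ 2 + 15) * halfMoment t 1 +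
      (Complex.I * t) ^ 5 + 14 * (Complex.I * t) ^ 3 + 33 * (Complex.I * t) := by
  have m1 := halfMoment_X_pow_succ t 0
  have m2 := halfMoment_X_pow_succ t 1
  have m3 := halfMoment_X_pow_succ t 2
  have m4 := halfMoment_X_pow_succ t 3
  have m5 := halfMoment_X_pow_succ t 4
  have m6 := halfMoment_X_pow_succ t 5
  norm_num at m1 m2 m3 m4 m5 m6
  rw [m1] at m2
  rw [m1, m2] at m3
  rw [m3, m2] at m4
  rw [m4, m3] at m5
  rw [m5, m4] at m6
  refine ⟨by rw [pow_one, m1], ?_, ?_, ?_, ?_⟩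
  · rw [m2]; ring
  · rw [m3]; ring
  · rw [m4]; ring
  · rw [m6]; ring

lemma halfMoment_tailPolyOne (t : ℝ) :
    halfMoment t tailPolyOne = -((((Complex.I * t) ^ 3 / 3 + 3 * (Complex.I * t) / 2)) *
      halfMoment t 1 + (Complex.I * t) ^ 2 / 3 + 7 / 6) := by
  obtain ⟨m1, m2, m3, m4, m6⟩ := halfMoment_X_pow_values t
  rw [tailPolyOne, halfMoment_add, halfMoment_C_mul, halfMoment_C_mul, m1, m3]
  ring

lemma halfMoment_tailPolyTwo (t : ℝ) :
    halfMoment t tailPolyTwo = ((Complex.I * t) ^ 6 / 18 + 3 * (Complex.I * t) ^ 4 / 4 +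
      15 * (Complex.I * t) ^ 2 / 8 + 11 / 24) * halfMoment t 1 +
      (Complex.I * t) ^ 5 / 18 + 25 * (Complex.I * t) ^ 3 / 36 + 31 * (Complex.I * t) / 24 := by
  obtain ⟨m1, m2, m3, m4, m6⟩ := halfMoment_X_pow_values t
  rw [tailPolyTwo, halfMoment_add, halfMoment_add, halfMoment_C_mul, halfMoment_C_mul,
    halfMoment_C_mul, m2, m4, m6]
  ring

/-- The coefficient of `1 / n` in the expansion of the characteristic function of `X_n`. -/
noncomputable def secondOrderCoeff (t : ℝ) : ℂ :=
  Complex.I * t * (((-t ^ 6 / 18 + 11 * t ^ 4 / 12 - 67 * t ^ 2 / 24 + 11 / 24 : ℝ) : ℂ) *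
    halfMoment t 1 + ((t ^ 5 / 18 - 31 * t ^ 3 / 36 + 49 * t / 24 : ℝ) : ℂ) * Complex.I)

/-- In the bracket only the first term has a real part. As `Re M ≠ 0`, a zero would make both real
polynomials vanish. -/
lemma secondOrderCoeff_ne_zero {t : ℝ} (ht : t ≠ 0) : secondOrderCoeff t ≠ 0 := by
  refine mul_ne_zero (mul_ne_zero Complex.I_ne_zero (Complex.ofReal_ne_zero.2 ht)) fun h => ?_
  have hre := congrArg Complex.re h
  rw [Complex.add_re, Complex.re_ofReal_mul, Complex.re_ofReal_mul, Complex.I_re, mul_zero,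
    add_zero, Complex.zero_re] at hre
  have hA := (mul_eq_zero.1 hre).resolve_right (re_halfMoment_one_ne_zero t)
  rw [hA, Complex.ofReal_zero, zero_mul, zero_add] at h
  have hB := Complex.ofReal_eq_zero.1 ((mul_eq_zero.1 h).resolve_right Complex.I_ne_zero)
  have hB' : t ^ 4 / 18 - 31 * t ^ 2 / 36 + 49 / 24 = 0 := by
    refine (mul_eq_zero.1 ?_).resolve_left ht
    linear_combination hB
  -- Euclidean division in `t ^ 2`: this combination of the two polynomials is `t ^ 2 - 57 / 4`,
  -- whose root is not a root of the second one.
  have hu : t ^ 2 = 57 / 4 := by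
    linear_combination 9 * hA + (9 * t ^ 2 - 9) * hB'
  have h4 : t ^ 4 = (57 / 4) ^ 2 := by rw [← hu]; ring
  rw [h4, hu] at hB'
  norm_num at hB'

lemma isBigO_charFun_sub {α : Type*} [LinearOrder α] (a : (n : ℕ) → Fin n → α)
    (ha : ∀ n, Function.Injective (a n)) (t : ℝ) :
    (fun n : ℕ => MeasureTheory.charFun (standardizedPassesLaw (a n)) t - charFunApprox n t -
      secondOrderCoeff t * (1 / (n : ℂ))) =O[atTop] (fun n : ℕ => (1 / √(n : ℝ)) ^ 3) := by
  obtain ⟨K, hK⟩ := exists_norm_sum_tailRatio_sub_le t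
  set H : ℕ → ℝ := fun n => 1 / √(n : ℝ) with hH
  set τ : ℂ := Complex.I * t with hτ
  set s₁ : ℂ := halfMoment t tailPolyOne - 1 / 2 with hs1
  set s₂ : ℂ := halfMoment t tailPolyTwo - τ / 12 with hs2
  set W : ℕ → ℂ := fun n => (1 - Complex.exp (-(τ * ((1 / √(n : ℝ) : ℝ) : ℂ)))) /
    ((1 / √(n : ℝ) : ℝ) : ℂ) with hW
  set S : ℕ → ℂ := fun n => (H n : ℂ) * ∑ j ∈ Finset.range n, (tailRatio n (j + 1) : ℂ) *
    Complex.exp (Complex.I * t * ((H n * ((j + 1 : ℕ) : ℝ) : ℝ) : ℂ)) with hS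
  set w : ℕ → ℂ := fun n => τ - τ ^ 2 / 2 * (H n : ℂ) + τ ^ 3 / 6 * (H n : ℂ) ^ 2 with hw
  set s : ℕ → ℂ := fun n => halfMoment t 1 + H n * s₁ + (H n : ℂ) ^ 2 * s₂ with hs
  have hH0 : Tendsto H atTop (nhds 0) := by
    simp only [hH, one_div]
    exact (Real.tendsto_sqrt_atTop.comp tendsto_natCast_atTop_atTop).inv_tendsto_atTop
  have hHc : Tendsto (fun n => (H n : ℂ)) atTop (nhds 0) := by
    have := (Complex.continuous_ofReal.tendsto 0).comp hH0
    rw [Complex.ofReal_zero] at this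
    exact this
  have hHO : (fun n => (H n : ℂ)) =O[atTop] (fun _ => (1 : ℝ)) := hHc.isBigO_one ℝ
  have hHH : (fun n => (H n : ℂ) ^ 3) =O[atTop] (fun n => H n ^ 3) :=
    IsBigO.of_bound 1 (Eventually.of_forall fun n => by
      rw [one_mul, norm_pow, norm_pow, Complex.norm_real])
  have hw1 : w =O[atTop] (fun _ => (1 : ℝ)) := by
    have : Tendsto w atTop (nhds (τ - τ ^ 2 / 2 * 0 + τ ^ 3 / 6 * 0 ^ 2)) :=
      (tendsto_const_nhds.sub (hHc.const_mul _)).add ((hHc.pow 2).const_mul _)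
    exact this.isBigO_one ℝ
  have hs1' : s =O[atTop] (fun _ => (1 : ℝ)) := by
    have : Tendsto s atTop (nhds (halfMoment t 1 + 0 * s₁ + 0 ^ 2 * s₂)) :=
      (tendsto_const_nhds.add (hHc.mul_const _)).add ((hHc.pow 2).mul_const _)
    exact this.isBigO_one ℝ
  have hWw : (fun n => W n - w n) =O[atTop] (fun n => H n ^ 3) := isBigO_one_sub_exp_neg τ
  have hpos : ∀ n : ℕ, 1 ≤ n → 0 < H n := fun n hn => by
    have : (0 : ℝ) < n := by exact_mod_cast hn
    simp only [hH]
    positivity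
  have hsq : ∀ n : ℕ, 1 ≤ n → H n ^ 2 * n = 1 := fun n hn => by
    have : (0 : ℝ) < n := by exact_mod_cast hn
    simp only [hH]
    rw [div_pow, Real.sq_sqrt this.le]
    field_simp
  have hSs : (fun n => S n - s n) =O[atTop] (fun n => H n ^ 3) := by
    refine IsBigO.of_bound K ?_
    filter_upwards [eventually_ge_atTop 1] with n hn
    rw [Real.norm_of_nonneg (pow_pos (hpos n hn) 3).le]
    exact hK n hn (H n) (hpos n hn) (hsq n hn)
  have hS1 : S =O[atTop] (fun _ => (1 : ℝ)) := by
    have h1 : (fun n => H n ^ 3) =O[atTop] (fun _ => (1 : ℝ)) := (hH0.pow 3).isBigO_one ℝ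
    simpa using (hSs.trans h1).add hs1'
  -- This is `W S - w s`, split so that each product has one bounded factor and one factor `O(h ^
  -- 3)`.
  have hprod : (fun n => (W n - w n) * S n + w n * (S n - s n)) =O[atTop] (fun n => H n ^ 3) := by
    have h1 := hWw.mul hS1
    have h2 := hw1.mul hSs
    simp only [mul_one, one_mul] at h1 h2
    exact h1.add h2
  -- These are the terms of `w s` of order `h ^ 3` and `h ^ 4`.
  have hrest : (fun n => (H n : ℂ) ^ 3 * ((τ ^ 3 / 6 * s₁ - τ ^ 2 / 2 * s₂) +
      τ ^ 3 / 6 * s₂ * H n)) =O[atTop] (fun n => H n ^ 3) := by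
    have h1 : (fun n => (τ ^ 3 / 6 * s₁ - τ ^ 2 / 2 * s₂) + τ ^ 3 / 6 * s₂ * (H n : ℂ))
        =O[atTop] (fun _ => (1 : ℝ)) :=
      (tendsto_const_nhds.add (hHc.const_mul (τ ^ 3 / 6 * s₂))).isBigO_one ℝ
    simpa using hHH.mul h1
  refine (hprod.add hrest).congr' ?_ EventuallyEq.rfl
  filter_upwards [eventually_ge_atTop 1] with n hn
  have hne : (H n : ℂ) ≠ 0 := Complex.ofReal_ne_zero.2 (hpos n hn).ne'
  have hn0 : (n : ℂ) ≠ 0 := by exact_mod_cast (by omega : n ≠ 0)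
  have hphi : MeasureTheory.charFun (standardizedPassesLaw (a n)) t = 1 + W n * S n := by
    rw [charFun_eq_sum_tailRatio hn (ha n) t le_rfl]
    simp only [hW, hS]
    change 1 + _ = 1 + (_ / (H n : ℂ)) * ((H n : ℂ) * _)
    rw [← mul_assoc, div_mul_cancel₀ _ hne]
  have hinv : 1 / (n : ℂ) = (H n : ℂ) ^ 2 := by
    rw [div_eq_iff hn0]
    exact_mod_cast (congrArg (fun x : ℝ => (x : ℂ)) (hsq n hn)).symm
  have hA : charFunApprox n t = (1 - (6 - (t : ℂ) ^ 2) * τ / 3 * H n) * (τ * halfMoment t 1) +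
      (1 - (5 - (t : ℂ) ^ 2) * τ / 3 * H n) := by
    have hsn : ((√(n : ℝ) : ℝ) : ℂ) = 1 / (H n : ℂ) := by
      simp only [hH]
      push_cast
      simp
    rw [charFunApprox, halfMoment_one_eq_normalCDF, hsn, ← hτ]
    field_simp
  -- Once everything is written in `τ`, the claim is a polynomial identity in `τ`, `M` and `h`, with
  -- `W` and `S` as further variables.
  have ht2 : (t : ℂ) ^ 2 = -τ ^ 2 := by
    rw [hτ, mul_pow, Complex.I_sq]
    ring
  have hC : secondOrderCoeff t = τ * ((τ ^ 6 / 18 + 11 * τ ^ 4 / 12 + 67 * τ ^ 2 / 24 + 11 / 24) *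
      halfMoment t 1 + (τ ^ 5 / 18 + 31 * τ ^ 3 / 36 + 49 * τ / 24)) := by
    have i2 := Complex.I_sq
    have i3 : Complex.I ^ 3 = -Complex.I := Complex.I_pow_three
    have i4 := Complex.I_pow_four
    have i5 : Complex.I ^ 5 = Complex.I := by rw [pow_succ, i4, one_mul]
    have i6 : Complex.I ^ 6 = -1 := by rw [pow_succ, i5, ← sq, i2]
    rw [secondOrderCoeff, hτ]
    simp only [mul_pow, i2, i3, i4, i5, i6]
    push_cast
    ring
  simp only [hphi, hinv, hA, hC, ht2, hw, hs, hs1, hs2, halfMoment_tailPolyOne,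
    halfMoment_tailPolyTwo, ← hτ]
  ring

lemma isLittleO_charFun_sub {α : Type*} [LinearOrder α] (a : (n : ℕ) → Fin n → α)
    (ha : ∀ n, Function.Injective (a n)) (t : ℝ) :
    (fun n : ℕ => MeasureTheory.charFun (standardizedPassesLaw (a n)) t - charFunApprox n t -
      secondOrderCoeff t * (1 / (n : ℂ))) =o[atTop] (fun n : ℕ => (1 : ℝ) / (n : ℝ)) := by
  refine (isBigO_charFun_sub a ha t).trans_isLittleO ?_
  have hH0 : (fun n : ℕ => 1 / √(n : ℝ)) =o[atTop] (fun _ => (1 : ℝ)) := by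
    rw [isLittleO_one_iff]
    simp only [one_div]
    exact (Real.tendsto_sqrt_atTop.comp tendsto_natCast_atTop_atTop).inv_tendsto_atTop
  have h := (isBigO_refl (fun n : ℕ => (1 : ℝ) / (n : ℝ)) atTop).mul_isLittleO hH0
  simp only [mul_one] at h
  refine h.congr (fun n => ?_) fun n => rfl
  rw [pow_succ, div_pow, Real.sq_sqrt (Nat.cast_nonneg n), one_pow]

end FinalExpansion

end BubbleSort

theorem mainTheorem7 {α : Type*} [LinearOrder α] (a : (n : ℕ) → Fin n → α)
    (ha : ∀ n, Function.Injective (a n)) :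
    (∀ t : ℝ,
      (fun n : ℕ => MeasureTheory.charFun (BubbleSort.standardizedPassesLaw (a n)) t -
          BubbleSort.charFunApprox n t) =O[atTop] (fun n : ℕ => (1 : ℝ) / (n : ℝ))) ∧
    (∀ t : ℝ, t ≠ 0 →
      (fun n : ℕ => MeasureTheory.charFun (BubbleSort.standardizedPassesLaw (a n)) t -
          BubbleSort.charFunApprox n t) =Θ[atTop] (fun n : ℕ => (1 : ℝ) / (n : ℝ))) := by
  have hcast : (fun n : ℕ => 1 / (n : ℂ)) =Θ[atTop] (fun n : ℕ => (1 : ℝ) / (n : ℝ)) :=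
    IsTheta.of_norm_eventuallyEq_norm (Eventually.of_forall fun n => by simp)
  refine ⟨fun t => ?_, fun t ht => ?_⟩
  · have h1 := (BubbleSort.isLittleO_charFun_sub a ha t).isBigO
    have h2 := hcast.isBigO.const_mul_left (BubbleSort.secondOrderCoeff t)
    simpa using h1.add h2
  · have h2 := (isTheta_const_mul_left (BubbleSort.secondOrderCoeff_ne_zero ht)).2 hcast
    have h1 := (BubbleSort.isLittleO_charFun_sub a ha t).trans_isTheta h2.symm
    -- The difference is `c / n + o(1 / n)` with `c ≠ 0`, hence asymptotically equivalent to `c /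
    -- n`.
    exact (IsEquivalent.isTheta h1).trans h2
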